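/- Let $(M,d)$ be a complete metric space with its Borel $\sigma$-algebra, and let $1\le p<\infty$. Let $\mathcal P(M)$ be the set of Borel probability measures $\mu$ on $M$ with $\mu(\operatorname{supp}\mu)=1$ (and similarly for $M\times M$), and let $\mathcal P^p(M)$ be the set of $\mu\in\mathcal P(M)$ with $\int_M d^p(x,y)\,d\mu(y)<\infty$ for some $x\in M$. It carries the $p$-Wasserstein distance $$d_p^W(\mu,\nu)=\Bigl[\inf_{\pi\in\Pi(\mu,\nu)}\int_{M\times M}d^p(x,y)\,d\pi(x,y)\Bigr]^{1/p},$$ where $\Pi(\mu,\nu)$ is the set of $\pi\in\mathcal P(M\times M)$ with marginals $\mu$ and $\nu$. Let $\beta:\mathcal P^p(M)\to M$ be a $p$-contractive barycentric map, that is, $\beta(\delta_x)=x$ for all $x\in M$ and $d(\beta(\mu),\beta(\nu))\le d_p^W(\mu,\nu)$ for all $\mu,\nu\in\mathcal P^p(M)$. Let $(\Omega,\mathcal A,\mathbf P)$ be a probability space and $T:\Omega\to\Omega$ a measurable $\mathbf P$-preserving transformation. Let $L^p(\Omega;M)$ be the set of strongly measurable functions $\varphi:\Omega\to M$ (i.e.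 almost everywhere limits of measurable functions with finitely many values) with $\int_\Omega d^p(x,\varphi(\omega))\,d\mathbf P(\omega)<\infty$ for some $x\in M$, where functions that agree almost everywhere are identified, with the distance $\mathbf d_p(\varphi,\psi)=\bigl[\int_\Omega d^p(\varphi(\omega),\psi(\omega))\,d\mathbf P(\omega)\bigr]^{1/p}$. For $\varphi\in L^p(\Omega;M)$ and $n\ge1$ let $\mu_n^\varphi(\omega)=\frac1n\sum_{k=0}^{n-1}\delta_{\varphi(T^k\omega)}$ and let $\beta(\mu_n^\varphi)$ denote the function $\omega\mapsto\beta(\mu_n^\varphi(\omega))$. Then there exists a map $\Gamma$ from $L^p(\Omega;M)$ onto $\{\varphi\in L^p(\Omega;M):\varphi\circ T=\varphi\}$ such that for every $\varphi,\psi\in L^p(\Omega;M)$: (i) $d(\beta(\mu_n^\varphi(\omega)),\Gamma(\varphi)(\omega))\to0$ as $n\to\infty$ for almost every $\omega\in\Omega$; (ii) $\beta(\mu_n^\varphi)\in L^p(\Omega;M)$ for all $n\ge1$, and $\mathbf d_p(\beta(\mu_n^\varphi),\Gamma(\varphi))\to0$ as $n\to\infty$; (iii) $\mathbf d_p(\Gamma(\varphi),\Gamma(\psi))\le\mathbf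 d_p(\varphi,\psi)$. Furthermore, if $T$ is ergodic, then for every $\varphi\in L^p(\Omega;M)$ the function $\Gamma(\varphi)$ is (almost everywhere) constant with value $E^\beta(\varphi):=\beta(\varphi_*\mathbf P)$, where $\varphi_*\mathbf P$ is the push-forward of $\mathbf P$ by $\varphi$. -/

import Mathlib

open MeasureTheory Set Filter Topology
open scoped ENNReal

noncomputable section

namespace BarycentricErgodic

section Measures

variable {X : Type*} [TopologicalSpace X] [MeasurableSpace X]

/-- A probability measure with full support, i.e. one that gives full mass to its own support:
`μ (supp μ) = 1`. (This is not the requirement `supp μ = X`.) For a metric space `X` with its Borel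
`σ`-algebra, the measures with this property form `𝒫(X)`. -/
structure IsFullProb (μ : Measure X) : Prop where
  isProb : IsProbabilityMeasure μ
  compl_support : μ μ.supportᶜ = 0

end Measures

variable {M : Type*} [MetricSpace M] [MeasurableSpace M]

/-- The couplings `Π(μ, ν)`: Borel probability measures `π` in `𝒫(M × M)` with marginals `μ`
and `ν`. The `σ`-algebra on `M × M` is the Borel one (it may be larger than the product
`σ`-algebra when `M` is not separable). -/
structure IsCoupling (μ ν : Measure M) (π : @Measure (M × M) (borel (M × M))) : Prop where
  isFullProb : @IsFullProb (M × M) _ (borel (M × M)) π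
  fst : ∀ B : Set M, MeasurableSet B → π (B ×ˢ univ) = μ B
  snd : ∀ B : Set M, MeasurableSet B → π (univ ×ˢ B) = ν B

/-- The `p`-Wasserstein distance, as an extended nonnegative real. -/
def wassersteinEDist (p : ℝ) (μ ν : Measure M) : ℝ≥0∞ :=
  (⨅ (π : @Measure (M × M) (borel (M × M))) (_ : IsCoupling μ ν π),
    @lintegral (M × M) (borel (M × M)) π (fun z => edist z.1 z.2 ^ p)) ^ (1 / p)

variable (M) in
/-- `𝒫^p(M)`: the measures in `𝒫(M)` with finite `p`-th moment. -/
def PMeas (p : ℝ) : Type _ :=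
  {μ : Measure M // IsFullProb μ ∧ ∃ x : M, ∫⁻ y, edist x y ^ p ∂μ < ∞}

/-- A measure that is concentrated on a separable set has full support. -/
theorem isFullProb_of_isSeparable {μ : Measure M} [IsProbabilityMeasure μ] {S : Set M}
    (hS : TopologicalSpace.IsSeparable S) (h : μ Sᶜ = 0) : IsFullProb μ := by
  refine ⟨inferInstance, ?_⟩
  have hsc : SecondCountableTopology S := hS.secondCountableTopology
  have hL : IsLindelof (S ∩ μ.supportᶜ) := by
    have h1 : IsLindelof ((Subtype.val : S → M) ⁻¹' μ.supportᶜ) :=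
      HereditarilyLindelofSpace.isLindelof _
    have h2 := h1.image continuous_subtype_val
    rwa [Subtype.image_preimage_coe] at h2
  have h0 : μ (S ∩ μ.supportᶜ) = 0 := by
    refine hL.induction_on (p := fun s => μ s = 0)
      (fun s t hst ht => measure_mono_null hst ht) ?_ ?_
    · intro F hF hs
      exact (measure_sUnion_null_iff hF).2 hs
    · intro x hx
      obtain ⟨U, hU, hU0⟩ := Measure.notMem_support_iff_exists.1 hx.2
      exact ⟨U, mem_nhdsWithin_of_mem_nhds hU, hU0⟩
  refine measure_mono_null (fun x hx => ?_) (measure_union_null h0 h)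
  by_cases hxS : x ∈ S
  · exact Or.inl ⟨hxS, hx⟩
  · exact Or.inr hxS

section Empirical

variable {Ω : Type*}

/-- The empirical measure `μ_n^f(ω) = (1/n) ∑_{k<n} δ_{f(T^k ω)}` (of interest for `n ≥ 1`). -/
def empiricalMeasure (T : Ω → Ω) (f : Ω → M) (n : ℕ) (ω : Ω) : Measure M :=
  (n : ℝ≥0∞)⁻¹ • ∑ k ∈ Finset.range n, Measure.dirac (f (T^[k] ω))

end Empirical

section Borel

variable [BorelSpace M]

theorem dirac_mem (p : ℝ) (hp : 1 ≤ p) (x : M) :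
    IsFullProb (Measure.dirac x) ∧ ∃ z : M, ∫⁻ y, edist z y ^ p ∂(Measure.dirac x) < ∞ := by
  refine ⟨isFullProb_of_isSeparable (S := {x}) (finite_singleton x).isSeparable (by simp),
    x, ?_⟩
  rw [lintegral_dirac]
  simp [show (0 : ℝ) < p by linarith]

/-- The point mass `δ_x` as an element of `𝒫^p(M)`. -/
def PMeas.dirac (p : ℝ) (hp : 1 ≤ p) (x : M) : PMeas M p :=
  ⟨Measure.dirac x, dirac_mem p hp x⟩

theorem empirical_mem {Ω : Type*} (p : ℝ) (hp : 1 ≤ p) (T : Ω → Ω) (f : Ω → M) (n : ℕ)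
    (hn : n ≠ 0) (ω : Ω) :
    IsFullProb (empiricalMeasure T f n ω) ∧
      ∃ z : M, ∫⁻ y, edist z y ^ p ∂(empiricalMeasure T f n ω) < ∞ := by
  have hprob : IsProbabilityMeasure (empiricalMeasure T f n ω) := by
    constructor
    simp only [empiricalMeasure, Measure.smul_apply, Measure.finsetSum_apply, measure_univ,
      Finset.sum_const, Finset.card_range, smul_eq_mul, nsmul_eq_mul, mul_one]
    exact ENNReal.inv_mul_cancel (by exact_mod_cast hn) (ENNReal.natCast_ne_top n)
  refine ⟨isFullProb_of_isSeparable
    (S := ((fun k => f (T^[k] ω)) '' (Finset.range n : Set ℕ)))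
    ((Finset.finite_toSet _).image _).isSeparable ?_, f ω, ?_⟩
  · simp only [empiricalMeasure, Measure.smul_apply, Measure.finsetSum_apply, smul_eq_mul]
    rw [Finset.sum_eq_zero, mul_zero]
    intro k hk
    rw [Measure.dirac_apply, indicator_of_notMem]
    simp only [mem_compl_iff, not_not]
    exact ⟨k, by simpa using hk, rfl⟩
  · simp only [empiricalMeasure, lintegral_smul_measure, lintegral_finsetSum_measure,
      lintegral_dirac, smul_eq_mul]
    refine ENNReal.mul_lt_top (by simp [pos_iff_ne_zero, hn]) (ENNReal.sum_lt_top.2 ?_)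
    intro k _
    exact ENNReal.rpow_lt_top_of_nonneg (by linarith) (edist_ne_top _ _)

/-- The empirical measure `μ_n^f(ω)`, `n ≥ 1`, as an element of `𝒫^p(M)`. -/
def PMeas.empirical {Ω : Type*} (p : ℝ) (hp : 1 ≤ p) (T : Ω → Ω) (f : Ω → M) (n : ℕ)
    (hn : n ≠ 0) (ω : Ω) : PMeas M p :=
  ⟨empiricalMeasure T f n ω, empirical_mem p hp T f n hn ω⟩

/-- `β : 𝒫^p(M) → M` is a `p`-contractive barycentric map: `β(δ_x) = x` for all `x`, and
`d(β(μ), β(ν)) ≤ d_p^W(μ, ν)` for all `μ, ν ∈ 𝒫^p(M)`. -/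
structure IsContractiveBarycentricMap (p : ℝ) (hp : 1 ≤ p) (β : PMeas M p → M) : Prop where
  dirac : ∀ x : M, β (PMeas.dirac p hp x) = x
  contractive : ∀ μ ν : PMeas M p, edist (β μ) (β ν) ≤ wassersteinEDist p μ.1 ν.1

end Borel

section Lp

variable {Ω : Type*} [MeasurableSpace Ω]

/-- The function `f : Ω → M` is `p`-th Bochner integrable: it is (almost everywhere equal to) a
strongly measurable function and `∫ d(x, f(ω))^p dP(ω) < ∞` for some `x ∈ M`. -/
def IsBochnerIntegrable (p : ℝ) (P : Measure Ω) (f : Ω → M) : Prop :=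
  AEStronglyMeasurable f P ∧ ∃ x : M, ∫⁻ ω, edist x (f ω) ^ p ∂P < ∞

/-- The distance `𝐝_p(f, g) = (∫ d(f(ω), g(ω))^p dP(ω))^{1/p}`, as an extended nonnegative
real. -/
def lpEDist (p : ℝ) (P : Measure Ω) (f g : Ω → M) : ℝ≥0∞ :=
  (∫⁻ ω, edist (f ω) (g ω) ^ p ∂P) ^ (1 / p)

variable (M) in
/-- `L^p(Ω; M)`: the `p`-th Bochner integrable functions `Ω → M` up to almost everywhere
equality. -/
def LpSpace (p : ℝ) (P : Measure Ω) : Type _ :=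
  {f : Ω →ₘ[P] M // IsBochnerIntegrable p P f}

/-- An element of `L^p(Ω; M)` is used as a function `Ω → M` through a (strongly measurable)
representative. -/
instance (p : ℝ) (P : Measure Ω) : CoeFun (LpSpace M p P) (fun _ => Ω → M) :=
  ⟨fun f => (f.1 : Ω → M)⟩

theorem map_mem [BorelSpace M] (p : ℝ) (P : Measure Ω) [IsProbabilityMeasure P]
    (f : LpSpace M p P) :
    IsFullProb (P.map f) ∧ ∃ z : M, ∫⁻ y, edist z y ^ p ∂(P.map f) < ∞ := by
  have hsm : StronglyMeasurable (f : Ω → M) := f.1.stronglyMeasurable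
  have hm : Measurable (f : Ω → M) := hsm.measurable
  have hprob : IsProbabilityMeasure (P.map f) := Measure.isProbabilityMeasure_map hm.aemeasurable
  refine ⟨isFullProb_of_isSeparable (S := closure (range (f : Ω → M)))
    hsm.isSeparable_range.closure ?_, ?_⟩
  · rw [Measure.map_apply hm isClosed_closure.measurableSet.compl]
    convert measure_empty (μ := P)
    ext ω
    simpa using subset_closure (mem_range_self ω)
  · obtain ⟨x, hx⟩ := f.2.2
    exact ⟨x, (lintegral_map_le _ _).trans_lt hx⟩

/-- The push-forward `φ_* P` of `φ ∈ L^p(Ω; M)`, as an element of `𝒫^p(M)`. -/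
def LpSpace.law [BorelSpace M] {p : ℝ} {P : Measure Ω} [IsProbabilityMeasure P]
    (f : LpSpace M p P) : PMeas M p :=
  ⟨P.map f, map_mem p P f⟩

/-- The `β`-expectation `E^β(φ) = β(φ_* P)`. -/
def betaExpectation [BorelSpace M] {p : ℝ} {P : Measure Ω} [IsProbabilityMeasure P]
    (β : PMeas M p → M) (f : LpSpace M p P) : M :=
  β f.law

/-- The `T`-invariant elements `{φ ∈ L^p(Ω; M) : φ ∘ T = φ}` (equality almost everywhere). -/
def invariants (M : Type*) [MetricSpace M] (p : ℝ) {P : Measure Ω} {T : Ω → Ω}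
    (hT : MeasurePreserving T P P) : Set (LpSpace M p P) :=
  {f | f.1.compMeasurePreserving T hT = f.1}

end Lp

end BarycentricErgodic

end

/-! Everything rests on a coupling remark. Two empirical measures along the same orbit are coupled
by drawing the time k uniformly, so contractivity of `β` bounds d^p of two barycentric averages by
the ordinary Birkhoff average of d^p(f, g) (`edist_barycentricAverage_rpow_le`). Integrating gives
nonexpansiveness in L^p, uniformly in n (`lpEDist_barycentricAverage_le`). Inserting this into the
weak-type maximal inequality for real functions gives a maximal inequality for barycentric averages.

By Banach's principle it then suffices to prove convergence on a dense class, here the simple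
functions. If f takes finitely many values, the weights of the empirical measures are Birkhoff
averages of indicators, which converge almost everywhere by Birkhoff's theorem for bounded
functions. On a fixed finite set, convergence of weights forces Wasserstein convergence
(`IsContractiveBarycentricMap.edist_rpow_le_of_finset`), so the barycenters are Cauchy. The maximal
inequality carries almost everywhere convergence to all of L^p, nonexpansiveness carries L^p
convergence, and Fatou's lemma makes the limit map contractive.

The limit is invariant because the averages at ω and Tω differ in a single atom. An invariant
function is fixed, since its empirical measures are point masses almost everywhere; hence
surjectivity. In the ergodic case the limiting weights of a simple function are those of its law,
and density extends the identification of the limit. -/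

namespace BarycentricErgodic

/-! ### Maximal inequality for real Birkhoff averages. -/

section MaximalInequality

variable {Ω : Type*}

/-- The maximum of the Birkhoff sums of `g` of length at most `n`, including the empty one. -/
noncomputable def maxBirkhoffSum (T : Ω → Ω) (g : Ω → ℝ) : ℕ → Ω → ℝ
  | 0, _ => 0
  | n + 1, ω => max 0 (g ω + maxBirkhoffSum T g n (T ω))

variable {T : Ω → Ω} {g : Ω → ℝ}

theorem maxBirkhoffSum_nonneg (n : ℕ) (ω : Ω) : 0 ≤ maxBirkhoffSum T g n ω := by
  cases n with
  | zero => exact le_rfl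
  | succ n => exact le_max_left _ _

theorem maxBirkhoffSum_le_succ (n : ℕ) (ω : Ω) :
    maxBirkhoffSum T g n ω ≤ maxBirkhoffSum T g (n + 1) ω := by
  induction n generalizing ω with
  | zero => exact maxBirkhoffSum_nonneg _ _
  | succ n ih =>
    have := ih (T ω)
    simp only [maxBirkhoffSum] at this ⊢
    gcongr

theorem monotone_maxBirkhoffSum : Monotone (maxBirkhoffSum T g) :=
  monotone_nat_of_le_succ fun n ω => maxBirkhoffSum_le_succ n ω

theorem birkhoffSum_le_maxBirkhoffSum (n : ℕ) (ω : Ω) :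
    birkhoffSum T g n ω ≤ maxBirkhoffSum T g n ω := by
  induction n generalizing ω with
  | zero => simp [maxBirkhoffSum]
  | succ n ih =>
    rw [birkhoffSum_succ']
    exact (add_le_add_right (ih _) _).trans (le_max_right _ _)

theorem exists_maxBirkhoffSum_eq (n : ℕ) (ω : Ω) :
    ∃ k, maxBirkhoffSum T g n ω = birkhoffSum T g k ω := by
  induction n generalizing ω with
  | zero => exact ⟨0, by simp [maxBirkhoffSum]⟩
  | succ n ih =>
    obtain ⟨k, hk⟩ := ih (T ω)
    rcases max_choice 0 (g ω + maxBirkhoffSum T g n (T ω)) with h | h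
    · exact ⟨0, by simpa [maxBirkhoffSum] using h⟩
    · exact ⟨k + 1, by rw [birkhoffSum_succ', ← hk]; exact h⟩

/-- Key inequality of Garsia's argument. A positive maximum is not attained by the empty sum, so the
first term splits off; the rest is a maximum over shorter sums, and lengthening the range only
increases it. -/
theorem le_add_of_maxBirkhoffSum_pos {n : ℕ} {ω : Ω} (h : 0 < maxBirkhoffSum T g n ω) :
    maxBirkhoffSum T g n ω ≤ g ω + maxBirkhoffSum T g n (T ω) := by
  cases n with
  | zero => exact absurd h (lt_irrefl _)
  | succ n =>
    have h1 : maxBirkhoffSum T g (n + 1) ω = g ω + maxBirkhoffSum T g n (T ω) := by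
      rcases max_choice 0 (g ω + maxBirkhoffSum T g n (T ω)) with h' | h'
      · exact absurd (h.trans_eq h') (lt_irrefl _)
      · exact h'
    rw [h1]
    gcongr
    exact maxBirkhoffSum_le_succ n _

theorem birkhoffSum_sub_const (c : ℝ) (n : ℕ) (ω : Ω) :
    birkhoffSum T (fun ω => g ω - c) n ω = birkhoffSum T g n ω - n * c := by
  simp [birkhoffSum, Finset.sum_sub_distrib]

theorem exists_birkhoffSum_sub_pos_iff (c : ℝ) (ω : Ω) :
    (∃ n, 0 < birkhoffSum T (fun ω => g ω - c) n ω) ↔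
      ∃ n : ℕ, c < birkhoffAverage ℝ T g (n + 1) ω := by
  have key : ∀ n : ℕ, 0 < birkhoffSum T (fun ω => g ω - c) (n + 1) ω ↔
      c < birkhoffAverage ℝ T g (n + 1) ω := fun n => by
    have : (0 : ℝ) < (n + 1 : ℕ) := by positivity
    rw [birkhoffSum_sub_const, sub_pos, birkhoffAverage, smul_eq_mul, ← div_eq_inv_mul,
      lt_div_iff₀ this, mul_comm]
  constructor
  · rintro ⟨_ | n, hn⟩
    · simp at hn
    · exact ⟨n, (key n).1 hn⟩
  · rintro ⟨n, hn⟩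
    exact ⟨n + 1, (key n).2 hn⟩

theorem abs_birkhoffAverage_le {C : ℝ} (hC : ∀ ω, |g ω| ≤ C) (n : ℕ) (ω : Ω) :
    |birkhoffAverage ℝ T g n ω| ≤ C := by
  have hC0 : 0 ≤ C := (abs_nonneg _).trans (hC ω)
  rcases eq_or_ne n 0 with rfl | hn
  · simpa using hC0
  have hn' : (0 : ℝ) < n := by positivity
  rw [birkhoffAverage, smul_eq_mul, ← div_eq_inv_mul, abs_div, Nat.abs_cast, div_le_iff₀ hn']
  refine (Finset.abs_sum_le_sum_abs _ _).trans ((Finset.sum_le_sum fun k _ => hC _).trans ?_)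
  simp [mul_comm]

/-- The points at which the upper limit of the ergodic averages of `g` exceeds `b`. -/
def upperLimitGT (T : Ω → Ω) (g : Ω → ℝ) (b : ℝ) : Set Ω :=
  {ω | ∃ m : ℕ, ∃ᶠ n in atTop, b + 1 / ((m : ℝ) + 1) < birkhoffAverage ℝ T g n ω}

/-- For bounded g the averages at ω and Tω differ by a null sequence. The slack 1/(m+1) in the
definition absorbs it, at the price of a larger m. -/
theorem preimage_upperLimitGT (hb : Bornology.IsBounded (range g)) (b : ℝ) :
    T ⁻¹' upperLimitGT T g b = upperLimitGT T g b := by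
  have key : ∀ u v : ℕ → ℝ, Tendsto (fun n => u n - v n) atTop (𝓝 0) →
      (∃ m : ℕ, ∃ᶠ n in atTop, b + 1 / ((m : ℝ) + 1) < u n) →
      ∃ m : ℕ, ∃ᶠ n in atTop, b + 1 / ((m : ℝ) + 1) < v n := by
    rintro u v huv ⟨m, hm⟩
    obtain ⟨k, hk⟩ := exists_nat_one_div_lt (show (0 : ℝ) < 1 / ((m : ℝ) + 1) by positivity)
    refine ⟨k, (hm.and_eventually (huv.eventually_lt_const (sub_pos.2 hk))).mono ?_⟩
    rintro n ⟨h1, h2⟩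
    linarith
  ext ω
  have h := tendsto_birkhoffAverage_apply_sub_birkhoffAverage' ℝ hb T ω
  refine ⟨key _ _ h, key _ _ ?_⟩
  simpa using h.neg

variable [MeasurableSpace Ω] {P : Measure Ω}

theorem integral_comp_measurePreserving (hT : MeasurePreserving T P P) (hg : Measurable g) :
    ∫ ω, g (T ω) ∂P = ∫ ω, g ω ∂P := by
  conv_rhs => rw [← hT.map_eq]
  exact (integral_map hT.aemeasurable hg.aestronglyMeasurable).symm

theorem measurable_maxBirkhoffSum (hT : Measurable T) (hg : Measurable g) (n : ℕ) :
    Measurable (maxBirkhoffSum T g n) := by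
  induction n with
  | zero => exact measurable_const
  | succ n ih => exact measurable_const.max (hg.add (ih.comp hT))

theorem integrable_maxBirkhoffSum (hT : MeasurePreserving T P P) (hg : Integrable g P) (n : ℕ) :
    Integrable (maxBirkhoffSum T g n) P := by
  induction n with
  | zero => exact integrable_zero _ _ _
  | succ n ih =>
    exact (integrable_zero _ _ _).sup (hg.add (hT.integrable_comp_of_integrable ih))

/-- **Maximal ergodic theorem**. -/
theorem setIntegral_nonneg_of_exists_birkhoffSum_pos (hT : MeasurePreserving T P P)
    (hgm : Measurable g) (hg : Integrable g P) :
    0 ≤ ∫ ω in {ω | ∃ n, 0 < birkhoffSum T g n ω}, g ω ∂P := by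
  have hU : {ω | ∃ n, 0 < birkhoffSum T g n ω} = ⋃ n, {ω | 0 < maxBirkhoffSum T g n ω} := by
    ext ω
    simp only [mem_ofPred_eq, mem_iUnion]
    constructor
    · rintro ⟨n, hn⟩
      exact ⟨n, hn.trans_le (birkhoffSum_le_maxBirkhoffSum n ω)⟩
    · rintro ⟨n, hn⟩
      obtain ⟨k, hk⟩ := exists_maxBirkhoffSum_eq (T := T) (g := g) n ω
      exact ⟨k, hk ▸ hn⟩
  have hmeas : ∀ n, MeasurableSet {ω | 0 < maxBirkhoffSum T g n ω} := fun n =>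
    measurableSet_lt measurable_const (measurable_maxBirkhoffSum hT.measurable hgm n)
  rw [hU]
  refine ge_of_tendsto' (tendsto_setIntegral_of_monotone hmeas ?_ hg.integrableOn) fun n => ?_
  · exact fun m n hmn ω hω => lt_of_lt_of_le hω (monotone_maxBirkhoffSum hmn ω)
  -- Let M be the maximum. On A one has M - M∘T ≤ g. Since M vanishes off A, while M∘T is
  -- nonnegative and has the same total integral as M, the left side has nonnegative integral over
  -- A.
  · set A := {ω | 0 < maxBirkhoffSum T g n ω}
    have hM := integrable_maxBirkhoffSum hT hg n
    have hMT : Integrable (fun ω => maxBirkhoffSum T g n (T ω)) P :=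
      hT.integrable_comp_of_integrable hM
    have h1 : ∫ ω in A, maxBirkhoffSum T g n ω ∂P = ∫ ω, maxBirkhoffSum T g n ω ∂P :=
      setIntegral_eq_integral_of_forall_compl_eq_zero fun ω hω =>
        le_antisymm (not_lt.1 hω) (maxBirkhoffSum_nonneg n ω)
    have h2 : ∫ ω in A, maxBirkhoffSum T g n (T ω) ∂P ≤ ∫ ω, maxBirkhoffSum T g n ω ∂P := by
      rw [← integral_comp_measurePreserving hT (measurable_maxBirkhoffSum hT.measurable hgm n)]
      exact setIntegral_le_integral hMT (ae_of_all _ fun ω => maxBirkhoffSum_nonneg n _)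
    have h3 : ∫ ω in A, (maxBirkhoffSum T g n ω - maxBirkhoffSum T g n (T ω)) ∂P
        ≤ ∫ ω in A, g ω ∂P := by
      refine setIntegral_mono_on (hM.sub hMT).integrableOn hg.integrableOn (hmeas n) fun ω hω => ?_
      linarith [le_add_of_maxBirkhoffSum_pos (mem_ofPred_eq ▸ hω)]
    rw [integral_sub hM.integrableOn hMT.integrableOn] at h3
    linarith

theorem measurable_birkhoffSum (hT : Measurable T) (hg : Measurable g) (n : ℕ) :
    Measurable (birkhoffSum T g n) :=
  Finset.measurable_fun_sum _ fun k _ => hg.comp (hT.iterate k)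

theorem measurable_birkhoffAverage (hT : Measurable T) (hg : Measurable g) (n : ℕ) :
    Measurable (birkhoffAverage ℝ T g n) :=
  (measurable_birkhoffSum hT hg n).const_smul (n : ℝ)⁻¹

/-- The maximal ergodic theorem for g - c: some Birkhoff sum of g - c is positive exactly where some
nonempty average of g exceeds c. -/
theorem mul_measureReal_le_setIntegral [IsFiniteMeasure P] (hT : MeasurePreserving T P P)
    (hgm : Measurable g) (hg : Integrable g P) (c : ℝ) :
    c * P.real {ω | ∃ n : ℕ, c < birkhoffAverage ℝ T g (n + 1) ω} ≤
      ∫ ω in {ω | ∃ n : ℕ, c < birkhoffAverage ℝ T g (n + 1) ω}, g ω ∂P := by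
  have h := setIntegral_nonneg_of_exists_birkhoffSum_pos hT (hgm.sub_const c)
    (hg.sub (integrable_const c))
  simp only [exists_birkhoffSum_sub_pos_iff] at h
  rw [integral_sub hg.integrableOn (integrable_const c)] at h
  simp only [integral_const, measureReal_restrict_apply_univ, smul_eq_mul] at h
  linarith

/-- The weak type `(1, 1)` maximal inequality for ergodic averages. -/
theorem measure_exists_lt_birkhoffAverage_le [IsFiniteMeasure P] (hT : MeasurePreserving T P P)
    (hgm : Measurable g) (hg : Integrable g P) (hg0 : 0 ≤ g) {c : ℝ} (hc : 0 < c) :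
    P {ω | ∃ n : ℕ, c < birkhoffAverage ℝ T g (n + 1) ω} ≤ ENNReal.ofReal ((∫ ω, g ω ∂P) / c) := by
  rw [← ofReal_measureReal]
  refine ENNReal.ofReal_le_ofReal ?_
  rw [le_div_iff₀' hc]
  exact (mul_measureReal_le_setIntegral hT hgm hg c).trans
    (setIntegral_le_integral hg (ae_of_all _ hg0))

end MaximalInequality

/-! ### Birkhoff's theorem for bounded functions. -/

section PointwiseErgodic

variable {Ω : Type*} [MeasurableSpace Ω] {T : Ω → Ω} {g : Ω → ℝ} {P : Measure Ω}

theorem measurableSet_upperLimitGT (hT : Measurable T) (hg : Measurable g) (b : ℝ) :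
    MeasurableSet (upperLimitGT T g b) := by
  simp only [upperLimitGT, frequently_atTop, ofPred_exists, ofPred_forall, ← exists_prop]
  refine .iUnion fun m => .iInter fun N => .iUnion fun n => .iUnion fun _ => ?_
  exact measurableSet_lt measurable_const (measurable_birkhoffAverage hT hg n)

/-- T also preserves the restriction of P to an invariant set E, so the maximal inequality applies
to that measure; its exceedance set contains E. -/
theorem mul_measureReal_le_setIntegral_of_subset [IsFiniteMeasure P]
    (hT : MeasurePreserving T P P) (hgm : Measurable g) (hg : Integrable g P) {b : ℝ}
    {E : Set Ω} (hE : MeasurableSet E) (hTE : T ⁻¹' E = E) (hEb : E ⊆ upperLimitGT T g b) :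
    b * P.real E ≤ ∫ ω in E, g ω ∂P := by
  have hTE' : MeasurePreserving T (P.restrict E) (P.restrict E) := by
    have := hT.restrict_preimage hE
    rwa [hTE] at this
  have h := mul_measureReal_le_setIntegral hTE' hgm hg.integrableOn b
  have hsub : E ⊆ {ω | ∃ n : ℕ, b < birkhoffAverage ℝ T g (n + 1) ω} := fun ω hω => by
    obtain ⟨m, hm⟩ := hEb hω
    obtain ⟨n, hn, hbn⟩ := (hm.and_eventually (eventually_ge_atTop 1)).exists.imp
      fun n hn => And.symm hn
    obtain ⟨k, rfl⟩ := Nat.exists_eq_add_of_le' hn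
    exact ⟨k, lt_trans (lt_add_of_pos_right b (by positivity)) hbn⟩
  have hms : MeasurableSet {ω | ∃ n : ℕ, b < birkhoffAverage ℝ T g (n + 1) ω} := by
    simp only [ofPred_exists]
    exact .iUnion fun n => measurableSet_lt measurable_const
      (measurable_birkhoffAverage hT.measurable hgm _)
  rwa [Measure.restrict_restrict hms, inter_eq_right.2 hsub, measureReal_restrict_apply hms,
    inter_eq_right.2 hsub] at h

/-- On this invariant set E the previous bound, for g and for -g, gives b P(E) ≤ ∫_E g ≤ a P(E),
which with a < b forces P(E) = 0. -/
theorem upperLimitGT_inter_null [IsFiniteMeasure P] (hT : MeasurePreserving T P P)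
    (hgm : Measurable g) (hb : Bornology.IsBounded (range g)) {a b : ℝ} (hab : a < b) :
    P (upperLimitGT T g b ∩ upperLimitGT T (-g) (-a)) = 0 := by
  have hb' : Bornology.IsBounded (range (-g)) := by
    have := hb.neg
    rwa [← image_neg_eq_neg, ← range_comp] at this
  have hg : Integrable g P := by
    obtain ⟨C, hC⟩ := hb.exists_norm_le
    exact .of_bound hgm.aestronglyMeasurable C (ae_of_all _ fun ω => hC _ (mem_range_self ω))
  set E := upperLimitGT T g b ∩ upperLimitGT T (-g) (-a)
  have hE : MeasurableSet E := (measurableSet_upperLimitGT hT.measurable hgm b).inter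
    (measurableSet_upperLimitGT hT.measurable hgm.neg (-a))
  have hTE : T ⁻¹' E = E := by
    rw [preimage_inter, preimage_upperLimitGT hb, preimage_upperLimitGT hb']
  have h1 := mul_measureReal_le_setIntegral_of_subset hT hgm hg hE hTE inter_subset_left
  have h2 := mul_measureReal_le_setIntegral_of_subset hT hgm.neg hg.neg hE hTE inter_subset_right
  simp only [Pi.neg_apply, integral_neg] at h2
  have h3 : P.real E = 0 := by nlinarith [measureReal_nonneg (μ := P) (s := E)]
  exact (measureReal_eq_zero_iff).1 h3

/-- **Birkhoff's pointwise ergodic theorem** for bounded functions. -/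
theorem ae_exists_tendsto_birkhoffAverage [IsFiniteMeasure P] (hT : MeasurePreserving T P P)
    (hgm : Measurable g) (hb : Bornology.IsBounded (range g)) :
    ∀ᵐ ω ∂P, ∃ c, Tendsto (fun n => birkhoffAverage ℝ T g n ω) atTop (𝓝 c) := by
  obtain ⟨C, hC⟩ := hb.exists_norm_le
  have hC' : ∀ ω, |g ω| ≤ C := fun ω => hC _ (mem_range_self ω)
  have h0 : ∀ᵐ ω ∂P, ∀ q r : ℚ, q < r →
      ω ∉ upperLimitGT T g r ∩ upperLimitGT T (-g) (-q) := by
    simp only [ae_all_iff]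
    intro q r hqr
    exact measure_eq_zero_iff_ae_notMem.1
      (upperLimitGT_inter_null hT hgm hb (Rat.cast_lt.2 hqr))
  filter_upwards [h0] with ω hω
  refine tendsto_of_no_upcrossings dense_univ (fun a _ b _ hab hfr => ?_) ?_ ?_
  -- Oscillation across (a, b) is oscillation across a rational subinterval (q, r), for which only
  -- countably many null sets were discarded.
  · have hgt : ∀ (f : Ω → ℝ) (x y : ℝ), x < y → (∃ᶠ n in atTop, y < birkhoffAverage ℝ T f n ω) →
        ω ∈ upperLimitGT T f x := fun f x y hxy hy => by
      obtain ⟨m, hm⟩ := exists_nat_one_div_lt (sub_pos.2 hxy)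
      exact ⟨m, hy.mono fun n hn => by linarith⟩
    obtain ⟨q, hq1, hq2⟩ := exists_rat_btwn hab
    obtain ⟨r, hr1, hr2⟩ := exists_rat_btwn hq2
    refine hω q r (by exact_mod_cast hr1) ⟨hgt g r b hr2 hfr.2, hgt (-g) _ (-a) (neg_lt_neg hq1) ?_⟩
    refine hfr.1.mono fun n hn => ?_
    simpa [birkhoffAverage_neg] using hn
  · exact isBoundedUnder_of ⟨C, fun n => (abs_le.1 (abs_birkhoffAverage_le hC' n ω)).2⟩
  · exact isBoundedUnder_of ⟨-C, fun n => (abs_le.1 (abs_birkhoffAverage_le hC' n ω)).1⟩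

theorem integral_birkhoffAverage (hT : MeasurePreserving T P P)
    (hgm : Measurable g) (hg : Integrable g P) (n : ℕ) :
    ∫ ω, birkhoffAverage ℝ T g (n + 1) ω ∂P = ∫ ω, g ω ∂P := by
  simp only [birkhoffAverage, birkhoffSum, smul_eq_mul, integral_const_mul]
  have hk : ∀ k, Integrable (fun ω => g (T^[k] ω)) P := fun k =>
    (hT.iterate k).integrable_comp_of_integrable hg
  rw [integral_finsetSum _ fun k _ => hk k]
  simp only [integral_comp_measurePreserving (hT.iterate _) hgm]
  rw [Finset.sum_const, Finset.card_range, nsmul_eq_mul, inv_mul_cancel_left₀ (by positivity)]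

/-- Birkhoff's theorem for bounded functions and ergodic maps. -/
theorem ae_tendsto_birkhoffAverage_integral [IsProbabilityMeasure P] (hT : Ergodic T P)
    (hgm : Measurable g) (hb : Bornology.IsBounded (range g)) :
    ∀ᵐ ω ∂P, Tendsto (fun n => birkhoffAverage ℝ T g n ω) atTop (𝓝 (∫ ω, g ω ∂P)) := by
  have hTP := hT.toMeasurePreserving
  have hconv := ae_exists_tendsto_birkhoffAverage hTP hgm hb
  obtain ⟨l, hlm, hl⟩ := exists_stronglyMeasurable_limit_of_tendsto_ae
    (fun n => (measurable_birkhoffAverage hTP.measurable hgm n).aestronglyMeasurable) hconv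
  -- Invariance makes the limit constant by ergodicity; dominated convergence then identifies the
  -- constant, as all averages have the integral of g.
  have hinv : l ∘ T =ᵐ[P] l := by
    filter_upwards [hl, hTP.quasiMeasurePreserving.ae hl] with ω h1 h2
    refine tendsto_nhds_unique h2 ?_
    simpa using (tendsto_birkhoffAverage_apply_sub_birkhoffAverage' ℝ hb T ω).add h1
  obtain ⟨c, hc⟩ := hT.ae_eq_const_of_ae_eq_comp_ae hlm.aestronglyMeasurable hinv
  obtain ⟨C, hC⟩ := hb.exists_norm_le
  have hg : Integrable g P :=
    .of_bound hgm.aestronglyMeasurable C (ae_of_all _ fun ω => hC _ (mem_range_self ω))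
  have hint : Tendsto (fun n => ∫ ω, birkhoffAverage ℝ T g n ω ∂P) atTop (𝓝 (∫ ω, l ω ∂P)) :=
    tendsto_integral_of_dominated_convergence (fun _ => C)
      (fun n => (measurable_birkhoffAverage hTP.measurable hgm n).aestronglyMeasurable)
      (integrable_const C)
      (fun n => ae_of_all _ (abs_birkhoffAverage_le (fun ω => hC _ (mem_range_self ω)) n)) hl
  have hint' : Tendsto (fun n => ∫ ω, birkhoffAverage ℝ T g n ω ∂P) atTop (𝓝 (∫ ω, g ω ∂P)) := by
    rw [← tendsto_add_atTop_iff_nat 1]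
    simp only [integral_birkhoffAverage hTP hgm hg]
    exact tendsto_const_nhds
  have hce : ∫ ω, g ω ∂P = c := by
    rw [tendsto_nhds_unique hint' hint, integral_congr_ae hc]
    simp
  filter_upwards [hl, hc] with ω h1 h2
  rw [hce]
  rwa [h2] at h1

end PointwiseErgodic

/-! ### Wasserstein bounds from random variables. -/

section Coupling

/-- A strongly measurable map has separable range, so its law is concentrated on a closed separable
set. -/
theorem isFullProb_map {Z E : Type*} [MetricSpace Z] [MeasurableSpace Z] [BorelSpace Z]
    [MeasurableSpace E] (Q : Measure E) [IsProbabilityMeasure Q] {X : E → Z}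
    (hX : StronglyMeasurable X) : IsFullProb (Q.map X) := by
  have hprob : IsProbabilityMeasure (Q.map X) :=
    Measure.isProbabilityMeasure_map hX.measurable.aemeasurable
  refine isFullProb_of_isSeparable (S := closure (range X)) hX.isSeparable_range.closure ?_
  rw [Measure.map_apply hX.measurable isClosed_closure.measurableSet.compl]
  convert measure_empty (μ := Q)
  ext e
  simpa using subset_closure (mem_range_self e)

theorem rpow_le_of_le_rpow_one_div {p : ℝ} (hp : 1 ≤ p) {a b : ℝ≥0∞} (h : a ≤ b ^ (1 / p)) :
    a ^ p ≤ b := by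
  have hp0 : 0 < p := by linarith
  rw [one_div] at h
  exact (ENNReal.le_rpow_inv_iff hp0).1 h

theorem lpEDist_rpow {Ω : Type*} [MeasurableSpace Ω] {p : ℝ} (hp : 1 ≤ p) (P : Measure Ω)
    {M : Type*} [MetricSpace M] (f g : Ω → M) :
    lpEDist p P f g ^ p = ∫⁻ ω, edist (f ω) (g ω) ^ p ∂P := by
  rw [lpEDist, ← ENNReal.rpow_mul, one_div_mul_cancel (by linarith), ENNReal.rpow_one]

variable {M : Type*} [MetricSpace M] [MeasurableSpace M] [BorelSpace M]
  {E : Type*} [MeasurableSpace E]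

/-- Two random variables on a common probability space bound the Wasserstein distance of
their laws. -/
theorem wassersteinEDist_map_le {p : ℝ} (hp : 1 ≤ p) (Q : Measure E) [IsProbabilityMeasure Q]
    {X Y : E → M} (hX : StronglyMeasurable X) (hY : StronglyMeasurable Y) :
    wassersteinEDist p (Q.map X) (Q.map Y) ≤ lpEDist p Q X Y := by
  let _ : MeasurableSpace (M × M) := borel (M × M)
  have : BorelSpace (M × M) := ⟨rfl⟩
  -- Strong measurability is essential: for nonseparable M the Borel σ-algebra of M × M may exceed
  -- the product one, and measurability of X and Y separately would not suffice.
  have hXY : StronglyMeasurable fun e => (X e, Y e) := hX.prodMk hY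
  refine ENNReal.rpow_le_rpow ?_ (by positivity)
  refine (iInf₂_le (Q.map fun e => (X e, Y e)) ⟨isFullProb_map Q hXY, fun B hB => ?_,
    fun B hB => ?_⟩).trans (lintegral_map_le _ _)
  · have hB' : MeasurableSet (B ×ˢ (univ : Set M)) := by
      rw [prod_univ]
      exact (continuous_fst : Continuous (Prod.fst : M × M → M)).measurable hB
    rw [Measure.map_apply hXY.measurable hB', Measure.map_apply hX.measurable hB]
    simp [prod_univ, preimage]
  · have hB' : MeasurableSet ((univ : Set M) ×ˢ B) := by
      rw [univ_prod]
      exact (continuous_snd : Continuous (Prod.snd : M × M → M)).measurable hB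
    rw [Measure.map_apply hXY.measurable hB', Measure.map_apply hY.measurable hB]
    simp [univ_prod, preimage]

theorem IsContractiveBarycentricMap.edist_le_lpEDist {p : ℝ} {hp : 1 ≤ p} {β : PMeas M p → M}
    (hβ : IsContractiveBarycentricMap p hp β) {μ ν : PMeas M p}
    (Q : Measure E) [IsProbabilityMeasure Q]
    {X Y : E → M} (hX : StronglyMeasurable X) (hY : StronglyMeasurable Y)
    (hμ : μ.1 = Q.map X) (hν : ν.1 = Q.map Y) :
    edist (β μ) (β ν) ≤ lpEDist p Q X Y := by
  refine (hβ.contractive μ ν).trans ?_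
  rw [hμ, hν]
  exact wassersteinEDist_map_le hp Q hX hY

end Coupling

/-! ### Coupling empirical measures by a uniform index. -/

section Uniform

/-- The uniform probability measure on `{0, …, n - 1}`. -/
noncomputable def uniformRange (n : ℕ) : Measure ℕ :=
  (n : ℝ≥0∞)⁻¹ • ∑ k ∈ Finset.range n, Measure.dirac k

theorem isProbabilityMeasure_uniformRange {n : ℕ} (hn : n ≠ 0) :
    IsProbabilityMeasure (uniformRange n) := by
  constructor
  simp only [uniformRange, Measure.smul_apply, Measure.finsetSum_apply, measure_univ,
    Finset.sum_const, Finset.card_range, smul_eq_mul, nsmul_eq_mul, mul_one]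
  exact ENNReal.inv_mul_cancel (by exact_mod_cast hn) (ENNReal.natCast_ne_top n)

theorem map_uniformRange {M : Type*} [MeasurableSpace M] (n : ℕ) (x : ℕ → M) :
    (uniformRange n).map x = (n : ℝ≥0∞)⁻¹ • ∑ k ∈ Finset.range n, Measure.dirac (x k) := by
  have hx : Measurable x := measurable_from_nat
  rw [uniformRange, Measure.map_smul, ← Measure.mapₗ_apply_of_measurable hx, map_sum]
  simp only [Measure.mapₗ_apply_of_measurable hx, Measure.map_dirac' hx]

theorem lintegral_uniformRange (n : ℕ) (F : ℕ → ℝ≥0∞) :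
    ∫⁻ k, F k ∂(uniformRange n) = (n : ℝ≥0∞)⁻¹ * ∑ k ∈ Finset.range n, F k := by
  simp [uniformRange, lintegral_smul_measure, lintegral_finsetSum_measure, lintegral_dirac]

variable {M : Type*} [MetricSpace M] [MeasurableSpace M] [BorelSpace M]
  {p : ℝ} {hp : 1 ≤ p} {β : PMeas M p → M}

/-- The index k, uniform on n values, is the common probability space; the coupling is the law of (x
k, y k). -/
theorem IsContractiveBarycentricMap.edist_rpow_le_average
    (hβ : IsContractiveBarycentricMap p hp β) {μ ν : PMeas M p} {n : ℕ} (hn : n ≠ 0)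
    {x y : ℕ → M} (hμ : μ.1 = (n : ℝ≥0∞)⁻¹ • ∑ k ∈ Finset.range n, Measure.dirac (x k))
    (hν : ν.1 = (n : ℝ≥0∞)⁻¹ • ∑ k ∈ Finset.range n, Measure.dirac (y k)) :
    edist (β μ) (β ν) ^ p ≤ (n : ℝ≥0∞)⁻¹ * ∑ k ∈ Finset.range n, edist (x k) (y k) ^ p := by
  have := isProbabilityMeasure_uniformRange hn
  rw [← map_uniformRange] at hμ hν
  rw [← lintegral_uniformRange n fun k => edist (x k) (y k) ^ p]
  exact rpow_le_of_le_rpow_one_div hp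
    (hβ.edist_le_lpEDist _ .of_discrete .of_discrete hμ hν)

end Uniform

/-! ### Measures on a fixed finite set. -/

section FiniteSupport

variable {M : Type*} [MetricSpace M] [MeasurableSpace M] [BorelSpace M]

theorem eq_sum_dirac_of_finset {μ : Measure M} {S : Finset M} (h : μ (S : Set M)ᶜ = 0) :
    μ = ∑ j : S, μ {(j : M)} • Measure.dirac (j : M) := by
  ext B hB
  rw [Finset.sum_coe_sort S fun j => μ {j} • Measure.dirac j, Measure.finsetSum_apply]
  simp only [Measure.smul_apply, Measure.dirac_apply' _ hB, smul_eq_mul]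
  have h1 : μ B = μ (B ∩ S) := by
    refine le_antisymm ?_ (measure_mono inter_subset_left)
    calc μ B ≤ μ (B ∩ S ∪ (S : Set M)ᶜ) := measure_mono fun x hx => by
          by_cases hxS : x ∈ (S : Set M)
          · exact Or.inl ⟨hx, hxS⟩
          · exact Or.inr hxS
      _ ≤ μ (B ∩ S) + μ (S : Set M)ᶜ := measure_union_le _ _
      _ = μ (B ∩ S) := by rw [h, add_zero]
  classical
  have h2 : B ∩ (S : Set M) = ⋃ j ∈ S.filter (· ∈ B), {j} := by
    ext x
    simp [and_comm]
  rw [h1, h2, measure_biUnion_finset (fun i _ j _ hij => by simpa using hij)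
    (fun j _ => measurableSet_singleton j), Finset.sum_filter]
  refine Finset.sum_congr rfl fun j _ => ?_
  by_cases hj : j ∈ B <;> simp [hj]

/-- On measures carried by a given finite set, convergence of the weights bounds the Wasserstein
distance. -/
theorem IsContractiveBarycentricMap.edist_rpow_le_of_finset {p : ℝ} {hp : 1 ≤ p}
    {β : PMeas M p → M} (hβ : IsContractiveBarycentricMap p hp β) {μ ν : PMeas M p}
    {S : Finset M} (hμ : μ.1 (S : Set M)ᶜ = 0) (hν : ν.1 (S : Set M)ᶜ = 0) :
    edist (β μ) (β ν) ^ p ≤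
      (∑ j : S, ∑ k : S, edist (j : M) k ^ p) * ∑ j : S, (μ.1 {(j : M)} - ν.1 {(j : M)}) := by
  have hp0 : 0 < p := by linarith
  have := μ.2.1.isProb
  have := ν.2.1.isProb
  have hμ' := eq_sum_dirac_of_finset hμ
  have hν' := eq_sum_dirac_of_finset hν
  set a : S → ℝ≥0∞ := fun j => μ.1 {(j : M)}
  set b : S → ℝ≥0∞ := fun j => ν.1 {(j : M)}
  have ha : ∑ j, a j = 1 := by
    simpa using (congrArg (fun m : Measure M => m univ) hμ').symm
  have hb : ∑ j, b j = 1 := by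
    simpa using (congrArg (fun m : Measure M => m univ) hν').symm
  -- The common mass m stays put, at no cost. Both measures have the same excess mass r over m, and
  -- only that is moved.
  set m : S → ℝ≥0∞ := fun j => min (a j) (b j)
  have ham : ∀ j, m j + (a j - b j) = a j := fun j => by
    simp only [m]
    rcases le_total (a j) (b j) with h | h
    · rw [min_eq_left h, tsub_eq_zero_of_le h, add_zero]
    · rw [min_eq_right h, add_tsub_cancel_of_le h]
  have hbm : ∀ j, m j + (b j - a j) = b j := fun j => by
    simp only [m]
    rcases le_total (a j) (b j) with h | h
    · rw [min_eq_left h, add_tsub_cancel_of_le h]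
    · rw [min_eq_right h, tsub_eq_zero_of_le h, add_zero]
  set r : ℝ≥0∞ := ∑ j, (a j - b j)
  have hm1 : ∑ j, m j ≤ 1 := ha ▸ Finset.sum_le_sum fun j _ => min_le_left _ _
  have hm : ∑ j, m j ≠ ∞ := ne_top_of_le_ne_top ENNReal.one_ne_top hm1
  have hra : ∑ j, m j + r = 1 := by
    rw [← Finset.sum_add_distrib, ← ha]
    exact Finset.sum_congr rfl fun j _ => ham j
  have hrb : ∑ j, m j + ∑ j, (b j - a j) = 1 := by
    rw [← Finset.sum_add_distrib, ← hb]
    exact Finset.sum_congr rfl fun j _ => hbm j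
  have hr : ∑ j, (b j - a j) = r := (ENNReal.add_right_inj hm).1 (hrb.trans hra.symm)
  have hr1 : r ≠ ∞ := ne_top_of_le_ne_top ENNReal.one_ne_top (hra ▸ le_add_self)
  -- Stated for c ≤ r so as to cover r = 0, where r⁻¹ = ∞ but c vanishes.
  have hcancel : ∀ c ≤ r, c * (r⁻¹ * r) = c := fun c hc => by
    rcases eq_or_ne r 0 with h0 | h0
    · rw [nonpos_iff_eq_zero.1 (hc.trans_eq h0), zero_mul]
    · rw [ENNReal.inv_mul_cancel h0 hr1, mul_one]
  have hale : ∀ j, a j - b j ≤ r := fun j =>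
    Finset.single_le_sum (f := fun j => a j - b j) (fun _ _ => zero_le) (Finset.mem_univ j)
  have hble : ∀ j, b j - a j ≤ r := fun j =>
    hr ▸ Finset.single_le_sum (f := fun j => b j - a j) (fun _ _ => zero_le) (Finset.mem_univ j)
  -- The excesses are coupled by their normalised product. Each entry is at most r, which yields the
  -- crude factor in the final bound.
  set w : S × S → ℝ≥0∞ := fun z => (a z.1 - b z.1) * (b z.2 - a z.2) * r⁻¹
  have hw1 : ∀ j, ∑ k, w (j, k) = a j - b j := fun j => by
    simp only [w]
    rw [← Finset.sum_mul, ← Finset.mul_sum, hr, mul_assoc, mul_comm r, hcancel _ (hale j)]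
  have hw2 : ∀ k, ∑ j, w (j, k) = b k - a k := fun k => by
    simp only [w]
    rw [← Finset.sum_mul, ← Finset.sum_mul, mul_comm r, mul_assoc, mul_comm r,
      hcancel _ (hble k)]
  have hwr : ∀ z, w z ≤ r := fun z =>
    (Finset.single_le_sum (f := fun k => w (z.1, k)) (fun _ _ => zero_le)
      (Finset.mem_univ z.2)).trans ((hw1 z.1).trans_le (hale z.1))
  set Q : Measure (S × S) := ∑ j, m j • Measure.dirac (j, j) + ∑ z, w z • Measure.dirac z
  have hQ : IsProbabilityMeasure Q := by
    constructor
    simp only [Q, Measure.add_apply, Measure.finsetSum_apply, Measure.smul_apply, measure_univ,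
      smul_eq_mul, mul_one]
    rw [Fintype.sum_prod_type]
    simp only [hw1]
    exact hra
  have hmap : ∀ x : S × S → M,
      Q.map x = ∑ j, m j • Measure.dirac (x (j, j)) + ∑ z, w z • Measure.dirac (x z) := fun x => by
    have hx : Measurable x := .of_discrete
    simp only [Q, ← Measure.mapₗ_apply_of_measurable hx, map_add, map_sum, map_smul]
    simp only [Measure.mapₗ_apply_of_measurable hx, Measure.map_dirac' hx]
  have h1 : μ.1 = Q.map fun z => (z.1 : M) := by
    rw [hmap, hμ', Fintype.sum_prod_type]
    simp only [← Finset.sum_smul, hw1]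
    rw [← Finset.sum_add_distrib]
    simp only [← add_smul, ham]
    rfl
  have h2 : ν.1 = Q.map fun z => (z.2 : M) := by
    rw [hmap, hν', Fintype.sum_prod_type_right]
    simp only [← Finset.sum_smul, hw2]
    rw [← Finset.sum_add_distrib]
    simp only [← add_smul, hbm]
    rfl
  refine (rpow_le_of_le_rpow_one_div hp
    (hβ.edist_le_lpEDist Q .of_discrete .of_discrete h1 h2)).trans ?_
  simp only [Q, lintegral_add_measure, lintegral_finsetSum_measure, lintegral_smul_measure,
    lintegral_dirac, edist_self, ENNReal.zero_rpow_of_pos hp0, mul_zero, Finset.sum_const_zero,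
    zero_add, smul_eq_mul]
  rw [mul_comm, Finset.mul_sum, Fintype.sum_prod_type]
  refine Finset.sum_le_sum fun j _ => ?_
  rw [Finset.mul_sum]
  exact Finset.sum_le_sum fun k _ => mul_le_mul_left (hwr _) _

end FiniteSupport

/-- Simple approximations of the coordinates combine into one that still has finitely many values,
because the index set is finite. -/
theorem stronglyMeasurable_pi {ι Ω M : Type*} [Finite ι] [MeasurableSpace Ω] [TopologicalSpace M]
    {f : Ω → ι → M} (hf : ∀ i, StronglyMeasurable fun ω => f ω i) : StronglyMeasurable f := by
  choose s hs using hf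
  refine ⟨fun n => ⟨fun ω i => s i n ω, fun y => ?_, ?_⟩, fun ω => tendsto_pi_nhds.2 fun i => ?_⟩
  · have : (fun ω i => s i n ω) ⁻¹' {y} = ⋂ i, s i n ⁻¹' {y i} := by
      ext ω
      simp [funext_iff]
    rw [this]
    have := Finite.to_countable (α := ι)
    exact .iInter fun i => (s i n).measurableSet_fiber _
  · refine (Finite.pi' fun i => (s i n).finite_range).subset ?_
    rintro _ ⟨ω, rfl⟩ i
    exact mem_range_self ω
  · exact hs i ω

/-! ### The L^p distance and density of simple functions. -/

section LpDistance

variable {Ω M : Type*} [MeasurableSpace Ω] [MetricSpace M] {p : ℝ} {P : Measure Ω}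
  {f g h : Ω → M}

theorem lpEDist_comm (f g : Ω → M) : lpEDist p P f g = lpEDist p P g f := by
  simp only [lpEDist, edist_comm]

theorem lpEDist_triangle (hp : 1 ≤ p) (hf : StronglyMeasurable f) (hg : StronglyMeasurable g)
    (hh : StronglyMeasurable h) :
    lpEDist p P f h ≤ lpEDist p P f g + lpEDist p P g h := by
  refine le_trans ?_ (ENNReal.lintegral_Lp_add_le (hf.edist hg).measurable.aemeasurable
    (hg.edist hh).measurable.aemeasurable hp)
  refine ENNReal.rpow_le_rpow (lintegral_mono fun ω => ?_) (by positivity)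
  exact ENNReal.rpow_le_rpow (edist_triangle _ _ _) (by linarith)

theorem measurable_edist_rpow (hf : StronglyMeasurable f) (hg : StronglyMeasurable g) :
    Measurable fun ω => edist (f ω) (g ω) ^ p :=
  (hf.edist hg).measurable.pow_const p

theorem ae_eq_of_lpEDist_eq_zero (hp : 1 ≤ p) (hf : StronglyMeasurable f)
    (hg : StronglyMeasurable g) (hfg : lpEDist p P f g = 0) : f =ᵐ[P] g := by
  have hp0 : 0 < p := by linarith
  have h1 : ∫⁻ ω, edist (f ω) (g ω) ^ p ∂P = 0 := by
    rw [← lpEDist_rpow hp, hfg, ENNReal.zero_rpow_of_pos hp0]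
  rw [lintegral_eq_zero_iff (measurable_edist_rpow hf hg)] at h1
  filter_upwards [h1] with ω hω
  exact edist_eq_zero.1 ((ENNReal.rpow_eq_zero_iff_of_pos hp0).1 hω)

theorem lpEDist_comp {T : Ω → Ω} (hT : MeasurePreserving T P P) (hf : StronglyMeasurable f)
    (hg : StronglyMeasurable g) : lpEDist p P (f ∘ T) (g ∘ T) = lpEDist p P f g := by
  unfold lpEDist
  rw [← hT.lintegral_comp (measurable_edist_rpow hf hg)]
  rfl

theorem lpEDist_const [IsProbabilityMeasure P] (hp : 1 ≤ p) (x y : M) :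
    lpEDist p P (fun _ => x) (fun _ => y) = edist x y := by
  rw [lpEDist, lintegral_const, measure_univ, mul_one, ← ENNReal.rpow_mul,
    mul_one_div_cancel (by linarith), ENNReal.rpow_one]

theorem lpEDist_lt_top_iff (hp : 1 ≤ p) :
    lpEDist p P f g < ∞ ↔ ∫⁻ ω, edist (f ω) (g ω) ^ p ∂P < ∞ :=
  ENNReal.rpow_lt_top_iff_of_pos (one_div_pos.2 (by linarith))

/-- Fatou's lemma for the `L^p` distance. -/
theorem lpEDist_le_of_tendsto (hp : 1 ≤ p) {u v : ℕ → Ω → M} {C : ℝ≥0∞}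
    (hu : ∀ n, StronglyMeasurable (u n)) (hv : ∀ n, StronglyMeasurable (v n))
    (hf : ∀ᵐ ω ∂P, Tendsto (fun n => u n ω) atTop (𝓝 (f ω)))
    (hg : ∀ᵐ ω ∂P, Tendsto (fun n => v n ω) atTop (𝓝 (g ω)))
    (hC : ∀ n, lpEDist p P (u n) (v n) ≤ C) : lpEDist p P f g ≤ C := by
  have hp0 : 0 < p := by linarith
  rw [lpEDist, one_div, ENNReal.rpow_inv_le_iff hp0]
  calc ∫⁻ ω, edist (f ω) (g ω) ^ p ∂P
      = ∫⁻ ω, liminf (fun n => edist (u n ω) (v n ω) ^ p) atTop ∂P := by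
        refine lintegral_congr_ae ?_
        filter_upwards [hf, hg] with ω h1 h2
        exact (((ENNReal.continuous_rpow_const (y := p)).tendsto _).comp
          (h1.edist h2)).liminf_eq.symm
    _ ≤ liminf (fun n => ∫⁻ ω, edist (u n ω) (v n ω) ^ p ∂P) atTop :=
        lintegral_liminf_le fun n => measurable_edist_rpow (hu n) (hv n)
    _ ≤ liminf (fun _ : ℕ => C ^ p) atTop := by
        refine liminf_le_liminf (Eventually.of_forall fun n => ?_)
        rw [← lpEDist_rpow hp]
        exact ENNReal.rpow_le_rpow (hC n) hp0.le
    _ = C ^ p := liminf_const _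

/-- Simple functions are dense in `L^p(Ω; M)`. -/
theorem exists_simpleFunc_lpEDist_lt [IsProbabilityMeasure P] (hp : 1 ≤ p)
    (hf : StronglyMeasurable f) {x : M} (hx : lpEDist p P (fun _ => x) f < ∞)
    {ε : ℝ≥0∞} (hε : 0 < ε) : ∃ s : SimpleFunc Ω M, lpEDist p P f s < ε := by
  have hp0 : 0 < p := by linarith
  borelize M
  have hsep : TopologicalSpace.IsSeparable (range f ∪ {x}) :=
    hf.isSeparable_range.union (finite_singleton x).isSeparable
  have := hsep.separableSpace
  set s : ℕ → SimpleFunc Ω M := SimpleFunc.approxOn f hf.measurable (range f ∪ {x}) x (by simp)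
  have hs : Tendsto (fun n => ∫⁻ ω, edist (f ω) (s n ω) ^ p ∂P) atTop (𝓝 (∫⁻ _, 0 ∂P)) := by
    -- With x as base point of the approximation, the distance from f to each approximant is at most
    -- d(x, f), which supplies the integrable majorant.
    refine tendsto_lintegral_of_dominated_convergence (fun ω => edist x (f ω) ^ p)
      (fun n => measurable_edist_rpow hf (s n).stronglyMeasurable) (fun n => ?_)
      ((lpEDist_lt_top_iff hp).1 hx).ne (ae_of_all _ fun ω => ?_)
    · refine ae_of_all _ fun ω => ENNReal.rpow_le_rpow ?_ hp0.le
      rw [edist_comm]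
      exact SimpleFunc.edist_approxOn_le hf.measurable (by simp) ω n
    · have h1 : Tendsto (fun n => s n ω) atTop (𝓝 (f ω)) :=
        SimpleFunc.tendsto_approxOn hf.measurable (by simp) (subset_closure (by simp))
      have h2 := ((ENNReal.continuous_rpow_const (y := p)).tendsto _).comp
        ((tendsto_const_nhds (x := f ω)).edist h1)
      rwa [edist_self, ENNReal.zero_rpow_of_pos hp0] at h2
  rw [lintegral_zero] at hs
  obtain ⟨n, hn⟩ := (hs.eventually_lt_const (ENNReal.rpow_pos_of_nonneg hε hp0.le)).exists
  refine ⟨s n, ?_⟩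
  rw [← lpEDist_rpow hp] at hn
  exact (ENNReal.rpow_lt_rpow_iff hp0).1 hn

end LpDistance

/-! ### Barycentric averages: regularity and contraction. -/

section BarycentricAverages

variable {Ω M : Type*} [MetricSpace M] [MeasurableSpace M] [BorelSpace M]
  {p : ℝ} (hp : 1 ≤ p) (β : PMeas M p → M) (T : Ω → Ω)

/-- The barycentric ergodic average `β(μ_{n+1}^f)`. -/
noncomputable def barycentricAverage (f : Ω → M) (n : ℕ) (ω : Ω) : M :=
  β (PMeas.empirical p hp T f (n + 1) n.succ_ne_zero ω)

variable {hp β T}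

/-- Only the orbit segment matters, so the system may be replaced by the shift on ℕ. -/
theorem barycentricAverage_congr {Ω' : Type*} {T' : Ω' → Ω'} {f : Ω → M} {f' : Ω' → M} {n : ℕ}
    {ω : Ω} {ω' : Ω'} (h : ∀ k < n + 1, f (T^[k] ω) = f' (T'^[k] ω')) :
    barycentricAverage hp β T f n ω = barycentricAverage hp β T' f' n ω' := by
  refine congrArg β (Subtype.ext ?_)
  simp only [PMeas.empirical, empiricalMeasure]
  congr 1
  exact Finset.sum_congr rfl fun k hk => by rw [h k (Finset.mem_range.1 hk)]

variable (hβ : IsContractiveBarycentricMap p hp β)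
include hβ

theorem edist_barycentricAverage_rpow_le (f g : Ω → M) (n : ℕ) (ω : Ω) :
    edist (barycentricAverage hp β T f n ω) (barycentricAverage hp β T g n ω) ^ p ≤
      ((n + 1 : ℕ) : ℝ≥0∞)⁻¹ *
        ∑ k ∈ Finset.range (n + 1), edist (f (T^[k] ω)) (g (T^[k] ω)) ^ p :=
  hβ.edist_rpow_le_average n.succ_ne_zero rfl rfl

theorem edist_barycentricAverage_le_of_forall {f g : Ω → M} {n : ℕ} {ω : Ω} {C : ℝ≥0∞}
    (h : ∀ k < n + 1, edist (f (T^[k] ω)) (g (T^[k] ω)) ≤ C) :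
    edist (barycentricAverage hp β T f n ω) (barycentricAverage hp β T g n ω) ≤ C := by
  have hp0 : 0 < p := by linarith
  rw [← ENNReal.rpow_le_rpow_iff hp0]
  refine (edist_barycentricAverage_rpow_le hβ f g n ω).trans ?_
  have : ∑ k ∈ Finset.range (n + 1), edist (f (T^[k] ω)) (g (T^[k] ω)) ^ p ≤
      ∑ _k ∈ Finset.range (n + 1), C ^ p := Finset.sum_le_sum fun k hk =>
    ENNReal.rpow_le_rpow (h k (Finset.mem_range.1 hk)) hp0.le
  refine (mul_le_mul_right this _).trans ?_
  rw [Finset.sum_const, Finset.card_range, nsmul_eq_mul, ← mul_assoc,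
    ENNReal.inv_mul_cancel (by simp) (ENNReal.natCast_ne_top _), one_mul]

theorem barycentricAverage_eq_of_forall {f : Ω → M} {n : ℕ} {ω : Ω} {x : M}
    (h : ∀ k < n + 1, f (T^[k] ω) = x) : barycentricAverage hp β T f n ω = x := by
  rw [← hβ.dirac x]
  refine congrArg β (Subtype.ext ?_)
  simp only [PMeas.empirical, empiricalMeasure, PMeas.dirac]
  rw [Finset.sum_congr rfl fun k hk => by rw [h k (Finset.mem_range.1 hk)], Finset.sum_const,
    Finset.card_range, ← Nat.cast_smul_eq_nsmul ℝ≥0∞, smul_smul,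
    ENNReal.inv_mul_cancel (by simp) (ENNReal.natCast_ne_top _), one_smul]

theorem barycentricAverage_const (x : M) (n : ℕ) :
    barycentricAverage hp β T (fun _ => x) n = fun _ => x :=
  funext fun _ => barycentricAverage_eq_of_forall hβ fun _ _ => rfl

/-- The two orbit segments share all points but one; matching the shared points leaves the pair of
endpoints as the only cost. -/
theorem edist_barycentricAverage_comp_rpow_le (f : Ω → M) (n : ℕ) (ω : Ω) :
    edist (barycentricAverage hp β T f n (T ω)) (barycentricAverage hp β T f n ω) ^ p ≤
      ((n + 1 : ℕ) : ℝ≥0∞)⁻¹ * edist (f (T^[n + 1] ω)) (f ω) ^ p := by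
  have hp0 : 0 < p := by linarith
  have h1 : (PMeas.empirical p hp T f (n + 1) n.succ_ne_zero (T ω)).1 =
      ((n + 1 : ℕ) : ℝ≥0∞)⁻¹ • ∑ k ∈ Finset.range (n + 1), Measure.dirac (f (T^[k + 1] ω)) := rfl
  -- The atoms are listed cyclically, with f ω last, to align them with those at Tω.
  have h2 : (PMeas.empirical p hp T f (n + 1) n.succ_ne_zero ω).1 =
      ((n + 1 : ℕ) : ℝ≥0∞)⁻¹ • ∑ k ∈ Finset.range (n + 1),
        Measure.dirac (if k < n then f (T^[k + 1] ω) else f ω) := by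
    simp only [PMeas.empirical, empiricalMeasure]
    rw [Finset.sum_range_succ', Finset.sum_range_succ (n := n), if_neg (lt_irrefl n)]
    congr 2
    exact Finset.sum_congr rfl fun k hk => by rw [if_pos (Finset.mem_range.1 hk)]
  refine (hβ.edist_rpow_le_average n.succ_ne_zero h1 h2).trans (mul_le_mul_right ?_ _)
  rw [Finset.sum_range_succ, if_neg (lt_irrefl n), Finset.sum_eq_zero, zero_add]
  intro k hk
  rw [if_pos (Finset.mem_range.1 hk), edist_self, ENNReal.zero_rpow_of_pos hp0]

/-- The average is a continuous function of the n + 1 orbit values, hence strongly measurable in ω.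
`Fin.ofNat` merely extends the tuple periodically to ℕ; only indices up to n enter. -/
theorem lipschitzWith_barycentricAverage_fin (n : ℕ) :
    LipschitzWith 1 fun x : Fin (n + 1) → M =>
      barycentricAverage hp β Nat.succ (fun k => x (Fin.ofNat (n + 1) k)) n 0 := fun x y => by
  rw [ENNReal.coe_one, one_mul]
  refine edist_barycentricAverage_le_of_forall hβ fun k _ => ?_
  exact edist_le_pi_edist x y _

variable [MeasurableSpace Ω]

theorem stronglyMeasurable_barycentricAverage (hT : Measurable T) {f : Ω → M}
    (hf : StronglyMeasurable f) (n : ℕ) : StronglyMeasurable (barycentricAverage hp β T f n) := by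
  have hpi : StronglyMeasurable fun ω (k : Fin (n + 1)) => f (T^[k] ω) :=
    stronglyMeasurable_pi fun k => hf.comp_measurable (hT.iterate k)
  have hcont := (lipschitzWith_barycentricAverage_fin hβ n).continuous.comp_stronglyMeasurable hpi
  have hfF : ∀ ω, barycentricAverage hp β Nat.succ
      (fun k => f (T^[(Fin.ofNat (n + 1) k : Fin (n + 1))] ω)) n 0 =
      barycentricAverage hp β T f n ω := fun ω => by
    refine barycentricAverage_congr fun k hk => ?_
    have h1 : Nat.succ^[k] 0 = k := by simp [Nat.succ_iterate]
    rw [h1, Fin.val_ofNat, Nat.mod_eq_of_lt hk]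
  rwa [funext hfF] at hcont

variable {P : Measure Ω}

/-- In the integrated pointwise bound every summand contributes the same integral, since each
iterate of T preserves P. -/
theorem lpEDist_barycentricAverage_le (hT : MeasurePreserving T P P) {f g : Ω → M}
    (hf : StronglyMeasurable f) (hg : StronglyMeasurable g) (n : ℕ) :
    lpEDist p P (barycentricAverage hp β T f n) (barycentricAverage hp β T g n) ≤
      lpEDist p P f g := by
  have hp0 : 0 < p := by linarith
  have hm := measurable_edist_rpow (p := p) hf hg
  have hmk : ∀ k, Measurable fun ω => edist (f (T^[k] ω)) (g (T^[k] ω)) ^ p := fun k =>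
    hm.comp (hT.iterate k).measurable
  refine ENNReal.rpow_le_rpow ?_ (by positivity)
  refine (lintegral_mono fun ω => edist_barycentricAverage_rpow_le hβ f g n ω).trans ?_
  rw [lintegral_const_mul' _ _ (by simp),
    lintegral_finsetSum _ fun k _ => hmk k]
  simp only [(hT.iterate _).lintegral_comp hm]
  rw [Finset.sum_const, Finset.card_range, nsmul_eq_mul, ← mul_assoc,
    ENNReal.inv_mul_cancel (by simp) (ENNReal.natCast_ne_top _), one_mul]

theorem lpEDist_const_barycentricAverage_le (hT : MeasurePreserving T P P) {f : Ω → M}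
    (hf : StronglyMeasurable f) (x : M) (n : ℕ) :
    lpEDist p P (fun _ => x) (barycentricAverage hp β T f n) ≤ lpEDist p P (fun _ => x) f := by
  have := lpEDist_barycentricAverage_le hβ hT (stronglyMeasurable_const (b := x)) hf n
  rwa [barycentricAverage_const hβ] at this

/-- Asymptotic invariance: the single mismatched pair has weight 1/(n+1), and its L^p size is
bounded by K uniformly in n. -/
theorem tendsto_lpEDist_barycentricAverage_comp [IsProbabilityMeasure P]
    (hT : MeasurePreserving T P P) {f : Ω → M}
    (hf : StronglyMeasurable f) {x : M} (hx : lpEDist p P (fun _ => x) f < ∞) :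
    Tendsto (fun n => lpEDist p P (barycentricAverage hp β T f n ∘ T)
      (barycentricAverage hp β T f n)) atTop (𝓝 0) := by
  have hp0 : 0 < p := by linarith
  set K := lpEDist p P (fun _ => x) f + lpEDist p P (fun _ => x) f
  have hK : K ≠ ∞ := (ENNReal.add_lt_top.2 ⟨hx, hx⟩).ne
  have hshift : ∀ n, lpEDist p P (f ∘ T^[n + 1]) f ≤ K := fun n => by
    have hTn := hT.iterate (n + 1)
    refine (lpEDist_triangle hp (hf.comp_measurable hTn.measurable)
      (stronglyMeasurable_const (b := x)) hf).trans (add_le_add_left ?_ _)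
    rw [lpEDist_comm]
    exact (lpEDist_comp hTn (stronglyMeasurable_const (b := x)) hf).le
  have hbound : ∀ n, lpEDist p P (barycentricAverage hp β T f n ∘ T)
      (barycentricAverage hp β T f n) ≤ (((n + 1 : ℕ) : ℝ≥0∞)⁻¹ * K ^ p) ^ (1 / p) := fun n => by
    refine ENNReal.rpow_le_rpow ?_ (by positivity)
    refine (lintegral_mono fun ω => edist_barycentricAverage_comp_rpow_le hβ f n ω).trans ?_
    rw [lintegral_const_mul' _ _ (by simp)]
    refine mul_le_mul_right ?_ _
    have := ENNReal.rpow_le_rpow (hshift n) hp0.le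
    rwa [lpEDist_rpow hp] at this
  have hlim : Tendsto (fun n : ℕ => (((n + 1 : ℕ) : ℝ≥0∞)⁻¹ * K ^ p) ^ (1 / p)) atTop (𝓝 0) := by
    have h1 : Tendsto (fun n : ℕ => ((n + 1 : ℕ) : ℝ≥0∞)⁻¹ * K ^ p) atTop (𝓝 (0 * K ^ p)) :=
      ENNReal.Tendsto.mul_const
        ((tendsto_add_atTop_iff_nat 1).2 ENNReal.tendsto_inv_nat_nhds_zero)
        (Or.inr (ENNReal.rpow_ne_top_of_nonneg hp0.le hK))
    have h2 := ((ENNReal.continuous_rpow_const (y := 1 / p)).tendsto _).comp h1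
    rwa [zero_mul, ENNReal.zero_rpow_of_pos (by positivity)] at h2
  exact tendsto_of_tendsto_of_tendsto_of_le_of_le tendsto_const_nhds hlim (fun _ => zero_le)
    hbound

end BarycentricAverages

/-! ### Convergence for simple functions. -/

section SimpleConvergence

theorem isBounded_range_indicator_one {Ω : Type*} (s : Set Ω) :
    Bornology.IsBounded (range (s.indicator (1 : Ω → ℝ))) := by
  refine ((finite_singleton (1 : ℝ)).insert 0).isBounded.subset ?_
  rintro _ ⟨ω, rfl⟩
  by_cases h : ω ∈ s <;> simp [h]

theorem sum_edist_rpow_ne_top {M : Type*} [MetricSpace M] {p : ℝ} (hp : 1 ≤ p) (S : Finset M) :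
    ∑ j : S, ∑ k : S, edist (j : M) k ^ p ≠ ∞ :=
  ENNReal.sum_ne_top.2 fun _ _ => ENNReal.sum_ne_top.2 fun _ _ =>
    ENNReal.rpow_ne_top_of_nonneg (by linarith) (edist_ne_top _ _)

variable {Ω M : Type*} [MetricSpace M] [MeasurableSpace M] [BorelSpace M] {T : Ω → Ω}

/-- The bridge to the real ergodic theorem: weights of atoms are visiting frequencies. -/
theorem empiricalMeasure_singleton (f : Ω → M) (n : ℕ) (ω : Ω) (j : M) :
    empiricalMeasure T f (n + 1) ω {j} =
      ENNReal.ofReal (birkhoffAverage ℝ T ((f ⁻¹' {j}).indicator 1) (n + 1) ω) := by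
  simp only [empiricalMeasure, Measure.smul_apply, Measure.finsetSum_apply, smul_eq_mul,
    birkhoffAverage, birkhoffSum]
  rw [ENNReal.ofReal_mul (by positivity), ENNReal.ofReal_inv_of_pos (by positivity),
    ENNReal.ofReal_natCast, ENNReal.ofReal_sum_of_nonneg (f := fun k =>
      (f ⁻¹' {j}).indicator (1 : Ω → ℝ) (T^[k] ω))
      fun k _ => indicator_nonneg (fun _ _ => zero_le_one) _]
  congr 1
  refine Finset.sum_congr rfl fun k _ => ?_
  rw [Measure.dirac_apply' _ (measurableSet_singleton j)]
  by_cases h : f (T^[k] ω) = j <;> simp [h]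

theorem empiricalMeasure_compl_finset (f : Ω → M) (n : ℕ) (ω : Ω) {S : Finset M}
    (hS : ∀ ω, f ω ∈ S) : empiricalMeasure T f n ω (S : Set M)ᶜ = 0 := by
  simp only [empiricalMeasure, Measure.smul_apply, Measure.finsetSum_apply, smul_eq_mul]
  rw [Finset.sum_eq_zero, mul_zero]
  intro k _
  rw [Measure.dirac_apply' _ (Finset.measurableSet _).compl, indicator_of_notMem]
  simpa using hS _

variable [MeasurableSpace Ω] {P : Measure Ω} {p : ℝ} {hp : 1 ≤ p} {β : PMeas M p → M}

/-- The finitely many weights converge by Birkhoff's theorem, so the finite-support bound makes the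
averages Cauchy. -/
theorem ae_exists_tendsto_barycentricAverage_simpleFunc [CompleteSpace M] [IsFiniteMeasure P]
    (hβ : IsContractiveBarycentricMap p hp β) (hT : MeasurePreserving T P P)
    (s : SimpleFunc Ω M) :
    ∀ᵐ ω ∂P, ∃ c, Tendsto (fun n => barycentricAverage hp β T s n ω) atTop (𝓝 c) := by
  have hp0 : 0 < p := by linarith
  have hconv : ∀ᵐ ω ∂P, ∀ j : s.range, ∃ c, Tendsto (fun n => birkhoffAverage ℝ T
      ((s ⁻¹' {(j : M)}).indicator (1 : Ω → ℝ)) n ω) atTop (𝓝 c) :=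
    ae_all_iff.2 fun j => ae_exists_tendsto_birkhoffAverage hT
      (measurable_one.indicator (s.measurableSet_fiber _)) (isBounded_range_indicator_one _)
  filter_upwards [hconv] with ω hω
  choose c hc using hω
  refine cauchySeq_tendsto_of_complete (EMetric.cauchySeq_iff.2 fun ε hε => ?_)
  have hq : ∀ j : s.range, Tendsto (fun n => empiricalMeasure T s (n + 1) ω {(j : M)}) atTop
      (𝓝 (ENNReal.ofReal (c j))) := fun j => by
    simp only [empiricalMeasure_singleton]
    exact ENNReal.tendsto_ofReal ((tendsto_add_atTop_iff_nat 1).2 (hc j))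
  have hlim : Tendsto (fun z : ℕ × ℕ => (∑ j : s.range, ∑ k : s.range, edist (j : M) k ^ p) *
      ∑ j : s.range, (empiricalMeasure T s (z.1 + 1) ω {(j : M)} -
        empiricalMeasure T s (z.2 + 1) ω {(j : M)})) atTop (𝓝 0) := by
    have h1 : Tendsto (fun z : ℕ × ℕ => ∑ j : s.range,
        (empiricalMeasure T s (z.1 + 1) ω {(j : M)} -
        empiricalMeasure T s (z.2 + 1) ω {(j : M)})) atTop
        (𝓝 (∑ j : s.range, (ENNReal.ofReal (c j) - ENNReal.ofReal (c j)))) := by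
      rw [← prod_atTop_atTop_eq]
      exact tendsto_finsetSum _ fun j _ => ENNReal.Tendsto.sub ((hq j).comp tendsto_fst)
        ((hq j).comp tendsto_snd) (Or.inl ENNReal.ofReal_ne_top)
    have h2 := ENNReal.Tendsto.const_mul h1 (Or.inr (sum_edist_rpow_ne_top hp s.range))
    simpa only [tsub_self, Finset.sum_const_zero, mul_zero] using h2
  have hev := hlim.eventually_lt_const (ENNReal.rpow_pos_of_nonneg hε hp0.le)
  obtain ⟨N, hN⟩ := eventually_atTop_prod_self.1 hev
  refine ⟨N, fun m hm n hn => (ENNReal.rpow_lt_rpow_iff hp0).1 ?_⟩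
  have hle := hβ.edist_rpow_le_of_finset
    (μ := PMeas.empirical p hp T s (m + 1) m.succ_ne_zero ω)
    (ν := PMeas.empirical p hp T s (n + 1) n.succ_ne_zero ω)
    (empiricalMeasure_compl_finset _ _ _ fun ω => s.mem_range_self ω)
    (empiricalMeasure_compl_finset _ _ _ fun ω => s.mem_range_self ω)
  exact hle.trans_lt (hN m n hm hn)

theorem ae_tendsto_barycentricAverage_simpleFunc_of_ergodic [IsProbabilityMeasure P]
    (hβ : IsContractiveBarycentricMap p hp β) (hT : Ergodic T P)
    (s : SimpleFunc Ω M) {ν : PMeas M p} (hν : ν.1 = P.map s) :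
    ∀ᵐ ω ∂P, Tendsto (fun n => barycentricAverage hp β T s n ω) atTop (𝓝 (β ν)) := by
  have hp0 : 0 < p := by linarith
  have hconv : ∀ᵐ ω ∂P, ∀ j : s.range, Tendsto (fun n => birkhoffAverage ℝ T
      ((s ⁻¹' {(j : M)}).indicator (1 : Ω → ℝ)) n ω) atTop
      (𝓝 (∫ ω, (s ⁻¹' {(j : M)}).indicator (1 : Ω → ℝ) ω ∂P)) :=
    ae_all_iff.2 fun j => ae_tendsto_birkhoffAverage_integral hT
      (measurable_one.indicator (s.measurableSet_fiber _)) (isBounded_range_indicator_one _)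
  have hνS : ν.1 (s.range : Set M)ᶜ = 0 := by
    rw [hν, Measure.map_apply s.measurable (Finset.measurableSet _).compl]
    convert measure_empty (μ := P)
    ext ω
    simp
  filter_upwards [hconv] with ω hω
  rw [tendsto_iff_edist_tendsto_0]
  have hq : ∀ j : s.range, Tendsto (fun n => empiricalMeasure T s (n + 1) ω {(j : M)}) atTop
      (𝓝 (ν.1 {(j : M)})) := fun j => by
    have h1 : ν.1 {(j : M)} =
        ENNReal.ofReal (∫ ω, (s ⁻¹' {(j : M)}).indicator (1 : Ω → ℝ) ω ∂P) := by
      rw [integral_indicator_one (s.measurableSet_fiber _), ofReal_measureReal, hν,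
        Measure.map_apply s.measurable (measurableSet_singleton _)]
    simp only [empiricalMeasure_singleton, h1]
    exact ENNReal.tendsto_ofReal ((tendsto_add_atTop_iff_nat 1).2 (hω j))
  have := ν.2.1.isProb
  have h1 : Tendsto (fun n : ℕ => ∑ j : s.range,
      (empiricalMeasure T s (n + 1) ω {(j : M)} - ν.1 {(j : M)})) atTop
      (𝓝 (∑ j : s.range, (ν.1 {(j : M)} - ν.1 {(j : M)}))) :=
    tendsto_finsetSum _ fun j _ => ENNReal.Tendsto.sub (hq j) tendsto_const_nhds
      (Or.inl (measure_ne_top _ _))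
  have h2 := ENNReal.Tendsto.const_mul h1 (Or.inr (sum_edist_rpow_ne_top hp s.range))
  simp only [tsub_self, Finset.sum_const_zero, mul_zero] at h2
  rw [ENNReal.tendsto_nhds_zero] at h2 ⊢
  intro ε hε
  filter_upwards [h2 (ε ^ p) (ENNReal.rpow_pos_of_nonneg hε hp0.le)] with n hn
  refine (ENNReal.rpow_le_rpow_iff hp0).1 (le_trans ?_ hn)
  exact hβ.edist_rpow_le_of_finset
    (μ := PMeas.empirical p hp T s (n + 1) n.succ_ne_zero ω)
    (empiricalMeasure_compl_finset _ _ _ fun ω => s.mem_range_self ω) hνS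

/-- For simple functions, almost everywhere convergence implies convergence in `L^p`. -/
theorem tendsto_lpEDist_barycentricAverage_simpleFunc [IsProbabilityMeasure P]
    (hβ : IsContractiveBarycentricMap p hp β) (hT : MeasurePreserving T P P)
    (s : SimpleFunc Ω M) {l : Ω → M} (hlm : StronglyMeasurable l)
    (hl : ∀ᵐ ω ∂P, Tendsto (fun n => barycentricAverage hp β T s n ω) atTop (𝓝 (l ω))) :
    Tendsto (fun n => lpEDist p P (barycentricAverage hp β T s n) l) atTop (𝓝 0) := by
  have hp0 : 0 < p := by linarith
  obtain ⟨ω₀⟩ := P.nonempty_of_neZero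
  set x := s ω₀
  -- All values of s lie within R of x, and so do all averages by nonexpansiveness; this gives a
  -- constant majorant.
  set R : ℝ≥0∞ := ∑ j ∈ s.range, edist x j
  have hR : R ≠ ∞ := ENNReal.sum_ne_top.2 fun _ _ => edist_ne_top _ _
  have hA : ∀ n ω, edist x (barycentricAverage hp β T s n ω) ≤ R := fun n ω => by
    have := edist_barycentricAverage_le_of_forall hβ (T := T) (f := fun _ => x) (g := s)
      (n := n) (ω := ω) (C := R) fun k _ =>
        Finset.single_le_sum (f := fun j => edist x j) (fun _ _ => zero_le) (s.mem_range_self _)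
    rwa [barycentricAverage_const hβ] at this
  have hsm := fun n => stronglyMeasurable_barycentricAverage hβ hT.measurable
    s.stronglyMeasurable n
  have h1 : Tendsto (fun n => ∫⁻ ω, edist (barycentricAverage hp β T s n ω) (l ω) ^ p ∂P) atTop
      (𝓝 (∫⁻ _, 0 ∂P)) := by
    refine tendsto_lintegral_of_dominated_convergence (fun _ => (R + R) ^ p)
      (fun n => measurable_edist_rpow (hsm n) hlm) (fun n => ?_) ?_ ?_
    · filter_upwards [hl] with ω hω
      refine ENNReal.rpow_le_rpow ?_ hp0.le
      have hxl : edist x (l ω) ≤ R :=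
        le_of_tendsto' (tendsto_const_nhds.edist hω) fun n => hA n ω
      exact (edist_triangle_left _ _ x).trans (add_le_add (hA n ω) hxl)
    · rw [lintegral_const, measure_univ, mul_one]
      exact ENNReal.rpow_ne_top_of_nonneg hp0.le (ENNReal.add_ne_top.2 ⟨hR, hR⟩)
    · filter_upwards [hl] with ω hω
      have := ((ENNReal.continuous_rpow_const (y := p)).tendsto _).comp
        (tendsto_iff_edist_tendsto_0.1 hω)
      rwa [ENNReal.zero_rpow_of_pos hp0] at this
  have h2 := ((ENNReal.continuous_rpow_const (y := 1 / p)).tendsto _).comp h1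
  rwa [lintegral_zero, ENNReal.zero_rpow_of_pos (by positivity)] at h2

end SimpleConvergence

/-! ### From simple functions to all of L^p. -/

section Convergence

variable {Ω M : Type*} [MetricSpace M] [MeasurableSpace M] [BorelSpace M] {T : Ω → Ω}
  [MeasurableSpace Ω] {P : Measure Ω} [IsProbabilityMeasure P] {p : ℝ} {hp : 1 ≤ p}
  {β : PMeas M p → M} (hβ : IsContractiveBarycentricMap p hp β)

include hβ

/-- The maximal inequality for barycentric averages. -/
theorem measure_exists_lt_edist_barycentricAverage_le (hT : MeasurePreserving T P P)
    {f g : Ω → M} (hf : StronglyMeasurable f) (hg : StronglyMeasurable g)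
    (hfg : lpEDist p P f g < ∞) {δ : ℝ} (hδ : 0 < δ) :
    P {ω | ∃ n, ENNReal.ofReal δ <
      edist (barycentricAverage hp β T f n ω) (barycentricAverage hp β T g n ω)} ≤
      lpEDist p P f g ^ p / ENNReal.ofReal (δ ^ p) := by
  have hp0 : 0 < p := by linarith
  -- If the barycentric averages are more than δ apart, the Birkhoff average of h exceeds δ^p, so
  -- the weak (1,1) inequality applies to h.
  set h : Ω → ℝ := fun ω => dist (f ω) (g ω) ^ p
  have hh : ∀ ω, edist (f ω) (g ω) ^ p = ENNReal.ofReal (h ω) := fun ω => by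
    rw [edist_dist, ENNReal.ofReal_rpow_of_nonneg dist_nonneg hp0.le]
  have hh0 : ∀ ω, 0 ≤ h ω := fun ω => Real.rpow_nonneg dist_nonneg _
  have hhm : Measurable h := (hf.dist hg).measurable.pow_const p
  have hint : ∫⁻ ω, ENNReal.ofReal (h ω) ∂P = lpEDist p P f g ^ p := by
    rw [lpEDist_rpow hp]
    exact lintegral_congr fun ω => (hh ω).symm
  have hhi : Integrable h P := by
    refine ⟨hhm.aestronglyMeasurable, ?_⟩
    rw [hasFiniteIntegral_iff_ofReal (ae_of_all _ hh0), hint]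
    exact ENNReal.rpow_lt_top_of_nonneg hp0.le hfg.ne
  have hδp : 0 < δ ^ p := Real.rpow_pos_of_pos hδ p
  rw [← hint, ← ofReal_integral_eq_lintegral_ofReal hhi (ae_of_all _ hh0),
    ← ENNReal.ofReal_div_of_pos hδp]
  refine (measure_mono ?_).trans (measure_exists_lt_birkhoffAverage_le hT hhm hhi hh0 hδp)
  rintro ω ⟨n, hn⟩
  refine ⟨n, (ENNReal.ofReal_lt_ofReal_iff_of_nonneg hδp.le).1 ?_⟩
  rw [← ENNReal.ofReal_rpow_of_nonneg hδ.le hp0.le]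
  refine ((ENNReal.rpow_lt_rpow_iff hp0).2 hn).trans_le
    ((edist_barycentricAverage_rpow_le hβ f g n ω).trans_eq ?_)
  simp only [hh, birkhoffAverage, birkhoffSum, smul_eq_mul]
  rw [ENNReal.ofReal_mul (by positivity), ENNReal.ofReal_inv_of_pos (by positivity),
    ENNReal.ofReal_natCast, ENNReal.ofReal_sum_of_nonneg fun k _ => hh0 _]

variable {f : Ω → M} (hf : StronglyMeasurable f) {x : M} (hx : lpEDist p P (fun _ => x) f < ∞)
include hf hx

/-- Banach's principle: outside a set of small measure the averages of f stay uniformly δ-close to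
the convergent averages of a simple function, so their eventual oscillation is at most 3δ. -/
theorem ae_exists_tendsto_barycentricAverage [CompleteSpace M] (hT : MeasurePreserving T P P) :
    ∀ᵐ ω ∂P, ∃ c, Tendsto (fun n => barycentricAverage hp β T f n ω) atTop (𝓝 c) := by
  have hp0 : 0 < p := by linarith
  set A := barycentricAverage hp β T
  have key : ∀ δ : ℝ, 0 < δ → ∀ᵐ ω ∂P, ∃ N, ∀ m ≥ N, ∀ n ≥ N,
      edist (A f m ω) (A f n ω) ≤ ENNReal.ofReal δ + ENNReal.ofReal δ + ENNReal.ofReal δ := by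
    intro δ hδ
    have hδp : ENNReal.ofReal (δ ^ p) ≠ 0 := by
      simpa using Real.rpow_pos_of_pos hδ p
    refine le_antisymm (le_of_forall_gt fun η hη => ?_) zero_le
    -- Chosen so that the maximal inequality bounds the exceptional set by less than η.
    have hε : 0 < (η * ENNReal.ofReal (δ ^ p)) ^ (1 / p) := by
      refine ENNReal.rpow_pos_of_nonneg (ENNReal.mul_pos hη.ne' hδp) (by positivity)
    obtain ⟨s, hs⟩ := exists_simpleFunc_lpEDist_lt hp hf hx hε
    have hsη : lpEDist p P f s ^ p / ENNReal.ofReal (δ ^ p) < η := by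
      rw [ENNReal.div_lt_iff (Or.inl hδp) (Or.inl ENNReal.ofReal_ne_top)]
      rw [one_div] at hs
      exact (ENNReal.lt_rpow_inv_iff hp0).1 hs
    refine lt_of_le_of_lt ?_ ((measure_exists_lt_edist_barycentricAverage_le hβ hT hf
      s.stronglyMeasurable (hs.trans_le le_top) hδ).trans_lt hsη)
    refine measure_mono_ae ?_
    filter_upwards [ae_exists_tendsto_barycentricAverage_simpleFunc hβ hT s] with ω hω hbad
    by_contra hmax
    refine hbad ?_
    have hmax' : ∀ n, edist (A f n ω) (A s n ω) ≤ ENNReal.ofReal δ := fun n =>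
      not_lt.1 fun hn => hmax ⟨n, hn⟩
    obtain ⟨c, hc⟩ := hω
    obtain ⟨N, hN⟩ := EMetric.cauchySeq_iff.1 hc.cauchySeq (ENNReal.ofReal δ)
      (ENNReal.ofReal_pos.2 hδ)
    refine ⟨N, fun m hm n hn => ?_⟩
    refine (edist_triangle4 _ (A s m ω) (A s n ω) _).trans ?_
    exact add_le_add (add_le_add (hmax' m) (hN m hm n hn).le) (edist_comm (A s n ω) _ ▸ hmax' n)
  have hall : ∀ᵐ ω ∂P, ∀ k : ℕ, ∃ N, ∀ m ≥ N, ∀ n ≥ N,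
      edist (A f m ω) (A f n ω) ≤ ENNReal.ofReal (1 / ((k : ℝ) + 1)) +
        ENNReal.ofReal (1 / ((k : ℝ) + 1)) + ENNReal.ofReal (1 / ((k : ℝ) + 1)) :=
    ae_all_iff.2 fun k => key _ (by positivity)
  filter_upwards [hall] with ω hω
  refine cauchySeq_tendsto_of_complete (EMetric.cauchySeq_iff.2 fun ε hε => ?_)
  have hlim : Tendsto (fun k : ℕ => ENNReal.ofReal (1 / ((k : ℝ) + 1)) +
      ENNReal.ofReal (1 / ((k : ℝ) + 1)) + ENNReal.ofReal (1 / ((k : ℝ) + 1))) atTop (𝓝 0) := by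
    have h1 := ENNReal.tendsto_ofReal (tendsto_one_div_add_atTop_nhds_zero_nat (𝕜 := ℝ))
    simpa using (h1.add h1).add h1
  obtain ⟨k, hk⟩ := (hlim.eventually_lt_const hε).exists
  obtain ⟨N, hN⟩ := hω k
  exact ⟨N, fun m hm n hn => (hN m hm n hn).trans_lt hk⟩

theorem tendsto_lpEDist_barycentricAverage [CompleteSpace M] (hT : MeasurePreserving T P P)
    {l : Ω → M} (hlm : StronglyMeasurable l)
    (hl : ∀ᵐ ω ∂P, Tendsto (fun n => barycentricAverage hp β T f n ω) atTop (𝓝 (l ω))) :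
    Tendsto (fun n => lpEDist p P (barycentricAverage hp β T f n) l) atTop (𝓝 0) := by
  rw [ENNReal.tendsto_nhds_zero]
  intro ε hε
  obtain ⟨δ, hδ, hδε⟩ : ∃ δ > 0, δ + δ + δ ≤ ε := by
    refine ⟨ε / 3, ENNReal.div_pos hε.ne' (by simp), le_of_eq ?_⟩
    exact ENNReal.add_thirds ε
  obtain ⟨s, hs⟩ := exists_simpleFunc_lpEDist_lt hp hf hx hδ
  have hAm := fun n => stronglyMeasurable_barycentricAverage hβ hT.measurable hf n
  have hAs := fun n => stronglyMeasurable_barycentricAverage hβ hT.measurable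
    s.stronglyMeasurable n
  obtain ⟨k, hkm, hk⟩ := exists_stronglyMeasurable_limit_of_tendsto_ae
    (fun n => (hAs n).aestronglyMeasurable)
    (ae_exists_tendsto_barycentricAverage_simpleFunc hβ hT s)
  have hfs := fun n => (lpEDist_barycentricAverage_le hβ hT hf s.stronglyMeasurable n).trans hs.le
  have hkl : lpEDist p P k l ≤ δ := by
    rw [lpEDist_comm]
    exact lpEDist_le_of_tendsto hp hAm hAs hl hk hfs
  filter_upwards [(ENNReal.tendsto_nhds_zero.1
    (tendsto_lpEDist_barycentricAverage_simpleFunc hβ hT s hkm hk)) δ hδ] with n hn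
  calc lpEDist p P (barycentricAverage hp β T f n) l
      ≤ lpEDist p P (barycentricAverage hp β T f n) k + lpEDist p P k l :=
        lpEDist_triangle hp (hAm n) hkm hlm
    _ ≤ lpEDist p P (barycentricAverage hp β T f n) (barycentricAverage hp β T s n) +
        lpEDist p P (barycentricAverage hp β T s n) k + lpEDist p P k l :=
        add_le_add_left (lpEDist_triangle hp (hAm n) (hAs n) hkm) _
    _ ≤ δ + δ + δ := add_le_add (add_le_add (hfs n) hn) hkl
    _ ≤ ε := hδε

/-- Invariance is read off in L^p: l∘T is compared with l through the averages and their
compositions with T, and each of the three distances tends to zero. -/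
theorem limit_comp_ae_eq [CompleteSpace M] (hT : MeasurePreserving T P P)
    {l : Ω → M} (hlm : StronglyMeasurable l)
    (hl : ∀ᵐ ω ∂P, Tendsto (fun n => barycentricAverage hp β T f n ω) atTop (𝓝 (l ω))) :
    l ∘ T =ᵐ[P] l := by
  have hlT := hlm.comp_measurable hT.measurable
  refine ae_eq_of_lpEDist_eq_zero hp hlT hlm (le_antisymm ?_ zero_le)
  have hAm := fun n => stronglyMeasurable_barycentricAverage hβ hT.measurable hf n
  have h1 := tendsto_lpEDist_barycentricAverage hβ hf hx hT hlm hl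
  have h2 := tendsto_lpEDist_barycentricAverage_comp hβ hT hf hx
  have h3 := (h1.add h2).add h1
  rw [add_zero, add_zero] at h3
  refine ge_of_tendsto' h3 fun n => ?_
  have hAT := (hAm n).comp_measurable hT.measurable
  refine (lpEDist_triangle hp hlT (hAm n) hlm).trans (add_le_add_left ?_ _)
  refine (lpEDist_triangle hp hlT hAT (hAm n)).trans (add_le_add_left ?_ _)
  rw [lpEDist_comm]
  exact (lpEDist_comp hT (hAm n) hlm).le

/-- For a simple s near f the limit is known. Both the limit and the barycenter of the law move by
at most the L^p distance from f to s. -/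
theorem limit_ae_eq_of_ergodic (hT : Ergodic T P)
    {l : Ω → M} (hlm : StronglyMeasurable l)
    (hl : ∀ᵐ ω ∂P, Tendsto (fun n => barycentricAverage hp β T f n ω) atTop (𝓝 (l ω)))
    {ν : PMeas M p} (hν : ν.1 = P.map f) :
    ∀ᵐ ω ∂P, l ω = β ν := by
  have hTP := hT.toMeasurePreserving
  refine ae_eq_of_lpEDist_eq_zero hp hlm (stronglyMeasurable_const (b := β ν))
    (le_antisymm (le_of_forall_gt fun ε hε => ?_) zero_le)
  obtain ⟨s, hs⟩ := exists_simpleFunc_lpEDist_lt hp hf hx (ENNReal.half_pos hε.ne')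
  have hsm := s.stronglyMeasurable
  have hxs : lpEDist p P (fun _ => x) s < ∞ :=
    (lpEDist_triangle hp stronglyMeasurable_const hf hsm).trans_lt
      (ENNReal.add_lt_top.2 ⟨hx, hs.trans_le le_top⟩)
  let νs : PMeas M p := ⟨P.map s, isFullProb_map P hsm, x,
    (lintegral_map_le _ _).trans_lt ((lpEDist_lt_top_iff hp).1 hxs)⟩
  have h1 : lpEDist p P l (fun _ => β νs) ≤ lpEDist p P f s :=
    lpEDist_le_of_tendsto hp
      (fun n => stronglyMeasurable_barycentricAverage hβ hTP.measurable hf n)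
      (fun n => stronglyMeasurable_barycentricAverage hβ hTP.measurable hsm n) hl
      (ae_tendsto_barycentricAverage_simpleFunc_of_ergodic hβ hT s rfl)
      (fun n => lpEDist_barycentricAverage_le hβ hTP hf hsm n)
  have h2 : edist (β νs) (β ν) ≤ lpEDist p P f s := by
    rw [lpEDist_comm]
    exact hβ.edist_le_lpEDist P hsm hf rfl hν
  calc lpEDist p P l (fun _ => β ν)
      ≤ lpEDist p P l (fun _ => β νs) + lpEDist p P (fun _ => β νs) (fun _ => β ν) :=
        lpEDist_triangle hp hlm stronglyMeasurable_const stronglyMeasurable_const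
    _ ≤ lpEDist p P f s + lpEDist p P f s := by
        rw [lpEDist_const hp]
        exact add_le_add h1 h2
    _ < ε / 2 + ε / 2 := ENNReal.add_lt_add hs hs
    _ = ε := ENNReal.add_halves ε

end Convergence

/-! ### The limit as an element of L^p. -/

section Limit

variable {Ω M : Type*} [MetricSpace M] {T : Ω → Ω} [MeasurableSpace Ω] {P : Measure Ω} {p : ℝ}

theorem LpSpace.stronglyMeasurable (f : LpSpace M p P) : StronglyMeasurable (f : Ω → M) :=
  f.1.stronglyMeasurable

theorem LpSpace.exists_lpEDist_const_lt_top (hp : 1 ≤ p) (f : LpSpace M p P) :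
    ∃ x : M, lpEDist p P (fun _ => x) f < ∞ :=
  f.2.2.imp fun _ hx => (lpEDist_lt_top_iff hp).2 hx

theorem LpSpace.ext {f g : LpSpace M p P} (h : (f : Ω → M) =ᵐ[P] g) : f = g :=
  Subtype.ext (AEEqFun.ext h)

theorem LpSpace.mem_invariants_iff {hT : MeasurePreserving T P P} {f : LpSpace M p P} :
    f ∈ invariants M p hT ↔ (f : Ω → M) ∘ T =ᵐ[P] f := by
  have h := f.1.coeFn_compMeasurePreserving hT
  constructor
  · intro hf
    rw [show f.1.compMeasurePreserving T hT = f.1 from hf] at h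
    exact h.symm
  · exact fun hf => AEEqFun.ext (h.trans hf)

theorem ae_forall_iterate_eq {M : Type*} (hT : MeasurePreserving T P P) {f : Ω → M}
    (hf : f ∘ T =ᵐ[P] f) :
    ∀ᵐ ω ∂P, ∀ k, f (T^[k] ω) = f ω := by
  rw [ae_all_iff]
  intro k
  induction k with
  | zero => exact ae_of_all _ fun _ => rfl
  | succ k ih =>
    filter_upwards [hT.quasiMeasurePreserving.ae ih, hf] with ω h1 h2
    rw [Function.iterate_succ_apply, h1]
    exact h2

variable [MeasurableSpace M] [BorelSpace M] {hp : 1 ≤ p}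
  {β : PMeas M p → M}

theorem isBochnerIntegrable_barycentricAverage (hβ : IsContractiveBarycentricMap p hp β)
    (hT : MeasurePreserving T P P) (φ : LpSpace M p P) (n : ℕ) :
    IsBochnerIntegrable p P (barycentricAverage hp β T φ n) := by
  obtain ⟨x, hx⟩ := φ.exists_lpEDist_const_lt_top hp
  have hsm := φ.stronglyMeasurable
  exact ⟨(stronglyMeasurable_barycentricAverage hβ hT.measurable hsm n).aestronglyMeasurable, x,
    (lpEDist_lt_top_iff hp).1 ((lpEDist_const_barycentricAverage_le hβ hT hsm x n).trans_lt hx)⟩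

theorem exists_ae_tendsto_barycentricAverage [CompleteSpace M] [IsProbabilityMeasure P]
    (hβ : IsContractiveBarycentricMap p hp β) (hT : MeasurePreserving T P P)
    (φ : LpSpace M p P) :
    ∃ γ : LpSpace M p P,
      ∀ᵐ ω ∂P, Tendsto (fun n => barycentricAverage hp β T φ n ω) atTop (𝓝 (γ ω)) := by
  obtain ⟨x, hx⟩ := φ.exists_lpEDist_const_lt_top hp
  have hsm := φ.stronglyMeasurable
  have hA := fun n => stronglyMeasurable_barycentricAverage hβ hT.measurable hsm n
  obtain ⟨l, hlm, hl⟩ := exists_stronglyMeasurable_limit_of_tendsto_ae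
    (fun n => (hA n).aestronglyMeasurable) (ae_exists_tendsto_barycentricAverage hβ hsm hx hT)
  have hlP : AEStronglyMeasurable l P := hlm.aestronglyMeasurable
  have hl' : ∀ᵐ ω ∂P, Tendsto (fun n => barycentricAverage hp β T φ n ω) atTop
      (𝓝 (AEEqFun.mk l hlP ω)) := by
    filter_upwards [hl, AEEqFun.coeFn_mk l hlP] with ω h1 h2
    rwa [h2]
  refine ⟨⟨AEEqFun.mk l hlP, AEEqFun.aestronglyMeasurable _, x, ?_⟩, hl'⟩
  -- Fatou's lemma against the constant x keeps the limit in L^p.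
  exact (lpEDist_lt_top_iff hp).1 ((lpEDist_le_of_tendsto hp (u := fun _ _ => x)
    (fun _ => stronglyMeasurable_const) hA (ae_of_all _ fun _ => tendsto_const_nhds) hl'
    fun n => lpEDist_const_barycentricAverage_le hβ hT hsm x n).trans_lt hx)

end Limit

end BarycentricErgodic

/-! ### The barycentric ergodic theorem. -/

open BarycentricErgodic in
theorem theorem4p2 {M : Type*} [MetricSpace M] [CompleteSpace M] [MeasurableSpace M] [BorelSpace M]
    {Ω : Type*} [MeasurableSpace Ω] (P : Measure Ω) [IsProbabilityMeasure P]
    (T : Ω → Ω) (hT : MeasurePreserving T P P)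
    (p : ℝ) (hp : 1 ≤ p) (β : PMeas M p → M) (hβ : IsContractiveBarycentricMap p hp β) :
    ∃ Γ : LpSpace M p P → LpSpace M p P,
      range Γ = invariants M p hT ∧
      (∀ φ : LpSpace M p P,
        -- (i) almost everywhere convergence
        (∀ᵐ ω ∂P, Tendsto
          (fun n : ℕ => β (PMeas.empirical p hp T φ (n + 1) n.succ_ne_zero ω))
          atTop (𝓝 (Γ φ ω))) ∧
        -- (ii) convergence in `L^p(Ω; M)`
        (∀ (n : ℕ) (hn : n ≠ 0),
          IsBochnerIntegrable p P (fun ω => β (PMeas.empirical p hp T φ n hn ω))) ∧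
        Tendsto
          (fun n : ℕ => lpEDist p P
            (fun ω => β (PMeas.empirical p hp T φ (n + 1) n.succ_ne_zero ω)) (Γ φ))
          atTop (𝓝 0)) ∧
      -- (iii) contractivity
      (∀ φ ψ : LpSpace M p P, lpEDist p P (Γ φ) (Γ ψ) ≤ lpEDist p P φ ψ) ∧
      -- the ergodic case
      (Ergodic T P → ∀ φ : LpSpace M p P, ∀ᵐ ω ∂P, Γ φ ω = betaExpectation β φ) := by
  choose Γ hΓ using fun φ : LpSpace M p P => exists_ae_tendsto_barycentricAverage hβ hT φ
  refine ⟨Γ, Subset.antisymm ?_ ?_, fun φ => ⟨hΓ φ, ?_, ?_⟩, fun φ ψ => ?_, fun hE φ => ?_⟩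
  · rintro _ ⟨φ, rfl⟩
    obtain ⟨x, hx⟩ := φ.exists_lpEDist_const_lt_top hp
    exact LpSpace.mem_invariants_iff.2
      (limit_comp_ae_eq hβ φ.stronglyMeasurable hx hT (Γ φ).stronglyMeasurable (hΓ φ))
  · intro φ hφ
    -- An invariant φ is its own image: it is constant along almost every orbit, so every average
    -- there equals φ(ω).
    refine ⟨φ, LpSpace.ext ?_⟩
    filter_upwards [hΓ φ, ae_forall_iterate_eq hT (LpSpace.mem_invariants_iff.1 hφ)] with ω h1 h2
    refine tendsto_nhds_unique h1 (tendsto_const_nhds.congr fun n => ?_)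
    exact (barycentricAverage_eq_of_forall hβ fun k _ => h2 k).symm
  · rintro (_ | n) hn
    · exact absurd rfl hn
    · exact isBochnerIntegrable_barycentricAverage hβ hT φ n
  · obtain ⟨x, hx⟩ := φ.exists_lpEDist_const_lt_top hp
    exact tendsto_lpEDist_barycentricAverage hβ φ.stronglyMeasurable hx hT
      (Γ φ).stronglyMeasurable (hΓ φ)
  · have hA := fun χ : LpSpace M p P =>
      stronglyMeasurable_barycentricAverage hβ hT.measurable χ.stronglyMeasurable
    exact lpEDist_le_of_tendsto hp (hA φ) (hA ψ) (hΓ φ) (hΓ ψ) fun n =>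
      lpEDist_barycentricAverage_le hβ hT φ.stronglyMeasurable ψ.stronglyMeasurable n
  · obtain ⟨x, hx⟩ := φ.exists_lpEDist_const_lt_top hp
    exact limit_ae_eq_of_ergodic hβ φ.stronglyMeasurable hx hE (Γ φ).stronglyMeasurable (hΓ φ) rfl
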